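/- Let $n\ge 1$ and let $\widetilde M$ be a compact smooth (Hausdorff, boundaryless) manifold of dimension $n+1$ with a projective structure $[\nabla]$, i.e. a class of smooth torsion-free affine connections, where $\hat\nabla\sim\nabla$ iff $\hat\nabla_a\xi^b=\nabla_a\xi^b+\Upsilon_a\xi^b+\Upsilon_c\xi^c\delta_a^b$ for some one-form $\Upsilon_a$ (written $\hat\nabla=\nabla+\Upsilon$). Let $\mathcal E(w)$ be the bundle of projective densities of weight $w$ (associated with the frame bundle and the representation $A\mapsto|\det A|^{w/(n+2)}$). Let $\mathcal T$ be the standard tractor bundle: in a scale $\nabla\in[\nabla]$ its sections are pairs $(\xi^a,\rho)$, $\xi^a\in\Gamma(T\widetilde M(-1))$, $\rho\in\Gamma(\mathcal E(-1))$, where under $\nabla\mapsto\nabla+\Upsilon$ the component $\xi^a$ is unchanged and $\rho\mapsto\rho-\Upsilon_a\xi^a$. Let $X:\mathcal E(-1)\to\mathcal T$, $\rho\mapsto(0,\rho)$, and $Z:\mathcal T\to T\widetilde M(-1)$, $(\xi^a,\rho)\mapsto\xi^a$, be the canonical maps, regarded as a section $X^A$ of $\mathcal T(1)$ and a section $Z^a_A$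 of $\mathcal T^*\otimes T\widetilde M(-1)$. The normal tractor connection is $$\nabla_c(\xi^a,\rho)=(\nabla_c\xi^a+\rho\,\delta_c^a,\ \nabla_c\rho-P_{ca}\xi^a),$$ where $P_{ab}$ is the projective Schouten tensor, $nP_{ab}=R_{ab}-\tfrac{2}{n+2}R_{[ab]}$, with $R_{ab}=R_{da}{}^d{}_b$ and $R_{ab}{}^c{}_d\,\xi^d=2\nabla_{[a}\nabla_{b]}\xi^c$. Suppose given a smooth symmetric non-degenerate tractor metric $H^{AB}\in\Gamma(S^2\mathcal T)$ of signature $(2,n)$ ($2$ minus signs, $n$ plus signs) which is parallel, $\nabla_cH^{AB}=0$, with pointwise inverse $\Phi_{AB}$, and a smooth nowhere-vanishing parallel tractor $I^A$, $\nabla_cI^A=0$, which is null: $\Phi_{AB}I^AI^B=0$. Put $$n^a=Z^a_AI^A,\qquad \sigma=\Phi_{AB}I^AX^B\in\Gamma(\mathcal E(1)),\qquad \lambda=\Phi_{AB}X^AX^B\in\Gamma(\mathcal E(2)),$$ write $\mathcal Z(\cdot)$ for the zero set in $\widetilde M$, and set $M=\widetilde M\setminus\mathcal Z(n)$. Then: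 1. $\mathcal Z(n)$ is a finite set of isolated points; hence $M$ is open and $\widetilde M=M\sqcup\mathcal Z(n)$. 2. $M=\mathcal O\sqcup\Sigma$, where $\mathcal O=\{x\in\widetilde M:\sigma(x)\ne0\}$ is open and $\Sigma=\mathcal Z(\sigma)\setminus\mathcal Z(n)$ is, if non-empty, a smooth embedded hypersurface. 3. $\Sigma=\Sigma^-\sqcup\Sigma^0\sqcup\Sigma^+$, where $\Sigma^-=\mathcal Z(\sigma)\cap\{\lambda<0\}$, $\Sigma^+=\mathcal Z(\sigma)\cap\{\lambda>0\}$ and $\Sigma^0=(\mathcal Z(\sigma)\cap\mathcal Z(\lambda))\setminus\mathcal Z(n)$. If non-empty, $\Sigma^\pm$ are smooth embedded submanifolds of codimension $1$ and $\Sigma^0$ is a smooth embedded submanifold of codimension $2$. Overall, $\widetilde M=\mathcal O\sqcup\Sigma^-\sqcup\Sigma^0\sqcup\Sigma^+\sqcup\mathcal Z(n)$, all unions being disjoint. -/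

import Mathlib

open scoped Manifold ContDiff Topology
open Bundle

noncomputable section

namespace ProjTractor

/-- The model space of a manifold of dimension `n + 1`. -/
abbrev Model (n : ℕ) : Type := EuclideanSpace ℝ (Fin (n + 1))

/-! ### Weighted vectors -/

/-- For an `(n+1)`-dimensional vector space `T` (a tangent space), `Weighted n T V w` is
`V ⊗ 𝓔(w)`, where `𝓔(w)` is the line associated with the frames of `T` and the representation
`A ↦ |det A| ^ (w / (n + 2))` of `GL(n+1)`: its elements are the functions `φ` from the frames
of `T` to `V` with `φ (f ∘ b) = |det f| ^ (-w / (n + 2)) • φ b`.  A frame is given as a tuple of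
`n + 1` vectors, and `φ` is extended by `0` to the tuples that are not frames. -/
def Weighted (n : ℕ) (T V : Type*) [AddCommGroup T] [Module ℝ T] [AddCommGroup V] [Module ℝ V]
    (w : ℝ) : Submodule ℝ ((Fin (n + 1) → T) → V) where
  carrier := {φ | (∀ b, ¬ LinearIndependent ℝ b → φ b = 0) ∧
    ∀ (f : T ≃ₗ[ℝ] T) (b : Fin (n + 1) → T),
      φ (fun i ↦ f (b i)) = (|LinearMap.det (f : T →ₗ[ℝ] T)| ^ (-w / ((n : ℝ) + 2))) • φ b}
  add_mem' := by
    rintro φ ψ ⟨h1, h2⟩ ⟨h3, h4⟩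
    exact ⟨fun b hb ↦ by simp [h1 b hb, h3 b hb], fun f b ↦ by simp [h2 f b, h4 f b]⟩
  zero_mem' := ⟨fun b _ ↦ rfl, fun f b ↦ by simp⟩
  smul_mem' := by
    rintro c φ ⟨h1, h2⟩
    exact ⟨fun b hb ↦ by simp [h1 b hb], fun f b ↦ by simp [h2 f b, smul_comm c]⟩

/-! ### The inverse of a form on the dual -/

/-- The inverse `Φ` of a bilinear form `H` on the dual of `V`: the form on `V` with
`H (Φ s) α = α s`.  It is meaningful when `H` is non-degenerate and `V` is finite-dimensional. -/
def inverseForm {V : Type*} [AddCommGroup V] [Module ℝ V]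
    (H : LinearMap.BilinForm ℝ (Module.Dual ℝ V)) : LinearMap.BilinForm ℝ V :=
  (LinearMap.leftInverse (H : Module.Dual ℝ V →ₗ[ℝ] Module.Dual ℝ (Module.Dual ℝ V))) ∘ₗ
    (Module.Dual.eval ℝ V)

/-- `inverseForm H` is the inverse of `H`, that is `Φ_{AB} H^{BC} = δ_A^C`. -/
theorem inverseForm_spec {V : Type*} [AddCommGroup V] [Module ℝ V] [FiniteDimensional ℝ V]
    (H : LinearMap.BilinForm ℝ (Module.Dual ℝ V)) (hH : H.Nondegenerate) (s : V)
    (α : Module.Dual ℝ V) : H (inverseForm H s) α = α s := by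
  have hker : LinearMap.ker (H : Module.Dual ℝ V →ₗ[ℝ] Module.Dual ℝ (Module.Dual ℝ V)) = ⊥ :=
    LinearMap.separatingLeft_iff_ker_eq_bot.mp hH.1
  have hsurj : Function.Surjective
      (H : Module.Dual ℝ V →ₗ[ℝ] Module.Dual ℝ (Module.Dual ℝ V)) :=
    (LinearMap.injective_iff_surjective_of_finrank_eq_finrank
      (Subspace.dual_finrank_eq (K := ℝ) (V := Module.Dual ℝ V)).symm).mp
      (LinearMap.ker_eq_bot.mp hker)
  obtain ⟨β, hβ⟩ := hsurj (Module.Dual.eval ℝ V s)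
  have h1 : inverseForm H s = β := by
    simp only [inverseForm, LinearMap.comp_apply]
    rw [← hβ]
    exact LinearMap.leftInverse_apply_of_inj hker β
  rw [h1, hβ]
  rfl

/-- The form `H` has signature `(q, p)`: it has an orthonormal basis with `q` vectors of square
`-1` and `p` vectors of square `+1`.  In particular it is symmetric and non-degenerate. -/
def HasSignature {W : Type*} [AddCommGroup W] [Module ℝ W]
    (H : LinearMap.BilinForm ℝ W) (q p : ℕ) : Prop :=
  ∃ e : Module.Basis (Fin q ⊕ Fin p) ℝ W,
    ∀ i j, H (e i) (e j) = if i = j then Sum.elim (fun _ ↦ (-1 : ℝ)) (fun _ ↦ 1) i else 0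

/-! ### Projective structures -/

section Manifold

variable (n : ℕ) (M : Type*) [TopologicalSpace M] [ChartedSpace (Model n) M]
  [IsManifold (𝓡 (n + 1)) ∞ M]

/-- Affine connections on `M`. -/
abbrev AffineConnection : Type _ :=
  CovariantDerivative (𝓡 (n + 1)) (Model n) (TangentSpace (𝓡 (n + 1)) : M → Type _)

variable {n M}

/-- `∇' = ∇ + Υ`, that is `∇'_a ξ^b = ∇_a ξ^b + Υ_a ξ^b + Υ_c ξ^c δ_a^b`.
For smooth connections the one-form `Υ` is automatically smooth, as one sees by taking traces. -/
def IsProjectiveChange (D D' : AffineConnection n M)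
    (Υ : ∀ x : M, TangentSpace (𝓡 (n + 1)) x →L[ℝ] ℝ) : Prop :=
  ∀ (ξ : ∀ x : M, TangentSpace (𝓡 (n + 1)) x) (x : M),
    MDifferentiableAt (𝓡 (n + 1)) ((𝓡 (n + 1)).prod 𝓘(ℝ, Model n))
      (fun y ↦ (⟨y, ξ y⟩ : TangentBundle (𝓡 (n + 1)) M)) x →
    ∀ v : TangentSpace (𝓡 (n + 1)) x, D' ξ x v = D ξ x v + Υ x v • ξ x + Υ x (ξ x) • v

variable (n M) in
/-- A projective structure: a projective equivalence class of smooth torsion-free affine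
connections. -/
structure ProjectiveStructure where
  carrier : Set (AffineConnection n M)
  nonempty : carrier.Nonempty
  smooth : ∀ D ∈ carrier, CovariantDerivative.ContMDiffCovariantDerivative D ∞
  torsionFree : ∀ D ∈ carrier, D.torsion = 0
  mem_iff : ∀ D ∈ carrier, ∀ D' : AffineConnection n M, D' ∈ carrier ↔
    (CovariantDerivative.ContMDiffCovariantDerivative D' ∞ ∧ D'.torsion = 0 ∧ ∃ Υ, IsProjectiveChange D D' Υ)

/-! ### Curvature -/

/-- The curvature `R(u, v) z = ∇_u ∇_v z - ∇_v ∇_u z - ∇_{[u, v]} z`, which is tensorial for a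
smooth connection and so is computed with arbitrary local extensions of the three vectors. -/
def curvature (D : AffineConnection n M) (x : M) (u v z : TangentSpace (𝓡 (n + 1)) x) :
    TangentSpace (𝓡 (n + 1)) x :=
  letI U := FiberBundle.extend (Model n) u
  letI V := FiberBundle.extend (Model n) v
  letI Z := FiberBundle.extend (Model n) z
  D (fun y ↦ D Z y (V y)) x u - D (fun y ↦ D Z y (U y)) x v
    - D Z x (VectorField.mlieBracket (𝓡 (n + 1)) U V x)

/-- A basis of the tangent space at `x`. -/
def tangentBasis (x : M) : Module.Basis (Fin (n + 1)) ℝ (TangentSpace (𝓡 (n + 1)) x) :=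
  (EuclideanSpace.basisFun (Fin (n + 1)) ℝ).toBasis

/-- The Ricci tensor `R_{ab} = R_{da}{}^d{}_b`, the trace of `u ↦ R(u, a) b`. -/
def ricci (D : AffineConnection n M) (x : M) (a b : TangentSpace (𝓡 (n + 1)) x) : ℝ :=
  ∑ i, (tangentBasis x).coord i (curvature D x (tangentBasis x i) a b)

/-- `β_{ab} = -(2 / (n + 2)) R_{[ab]}`, the curvature of `𝓔(1)`. -/
def beta (D : AffineConnection n M) (x : M) (a b : TangentSpace (𝓡 (n + 1)) x) : ℝ :=
  -(2 / ((n : ℝ) + 2)) * ((ricci D x a b - ricci D x b a) / 2)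

/-- The projective Schouten tensor, `n P_{ab} = R_{ab} + β_{ab}`. -/
def schouten (D : AffineConnection n M) (x : M) (a b : TangentSpace (𝓡 (n + 1)) x) : ℝ :=
  (ricci D x a b + beta D x a b) / n

/-! ### The tractor bundle -/

/-- The fibre at `x` of the density bundle `𝓔(w)`. -/
abbrev Density (n : ℕ) {M : Type*} [TopologicalSpace M] [ChartedSpace (Model n) M]
    (x : M) (w : ℝ) : Type _ :=
  Weighted n (TangentSpace (𝓡 (n + 1)) x) ℝ w

/-- The fibre at `x` of `TM(w)`. -/
abbrev WeightedTangent (n : ℕ) {M : Type*} [TopologicalSpace M] [ChartedSpace (Model n) M]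
    (x : M) (w : ℝ) : Type _ :=
  Weighted n (TangentSpace (𝓡 (n + 1)) x) (TangentSpace (𝓡 (n + 1)) x) w

variable (p : ProjectiveStructure n M)

/-- The fibre at `x` of the standard tractor bundle.  A choice of scale (a connection `∇` of the
class) identifies a tractor with a pair `(ξ, ρ)` in `TM(-1) ⊕ 𝓔(-1)`, written
`ξ^a W_a^A + ρ X^A`; here `ξ` does not depend on the scale, and `ρ` becomes `ρ - Υ_a ξ^a` when
`∇` is replaced by `∇ + Υ`.  A tractor is the scale-independent object: `ξ` together with the
family of its components `ρ` in all scales. -/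
def tractorSubmodule (x : M) :
    Submodule ℝ (WeightedTangent n x (-1) × (p.carrier → Density n x (-1))) where
  carrier := {t | ∀ (D D' : p.carrier) (Υ : ∀ y : M, TangentSpace (𝓡 (n + 1)) y →L[ℝ] ℝ),
    IsProjectiveChange D.1 D'.1 Υ →
      ∀ b, (t.2 D').1 b = (t.2 D).1 b - Υ x (t.1.1 b)}
  add_mem' := by
    intro s t hs ht D D' Υ h b
    have h1 := hs D D' Υ h b
    have h2 := ht D D' Υ h b
    simp only [Prod.fst_add, Prod.snd_add, Pi.add_apply, Submodule.coe_add, map_add] at *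
    rw [h1, h2]; ring
  zero_mem' := by
    intro D D' Υ h b
    simp
  smul_mem' := by
    intro c t ht D D' Υ h b
    have h1 := ht D D' Υ h b
    simp only [Prod.smul_fst, Prod.smul_snd, Pi.smul_apply, Submodule.coe_smul, map_smul,
      smul_eq_mul] at *
    rw [h1]; ring

/-- The fibre `𝒯_x` of the standard tractor bundle. -/
def Tractor (x : M) : Type _ := tractorSubmodule p x

instance (x : M) : AddCommGroup (Tractor p x) :=
  inferInstanceAs (AddCommGroup (tractorSubmodule p x))

instance (x : M) : Module ℝ (Tractor p x) :=
  inferInstanceAs (Module ℝ (tractorSubmodule p x))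

/-- The underlying scale-independent part and family of components of a tractor. -/
def tractorSubtype (x : M) :
    Tractor p x →ₗ[ℝ] WeightedTangent n x (-1) × (p.carrier → Density n x (-1)) :=
  (tractorSubmodule p x).subtype

/-- The canonical map `Z : 𝒯 → TM(-1)`. -/
def projZ (x : M) : Tractor p x →ₗ[ℝ] WeightedTangent n x (-1) :=
  LinearMap.fst ℝ _ _ ∘ₗ tractorSubtype p x

/-- The map `Y : 𝒯 → 𝓔(-1)` of the scale `D`. -/
def projY (D : p.carrier) (x : M) : Tractor p x →ₗ[ℝ] Density n x (-1) :=
  LinearMap.proj D ∘ₗ LinearMap.snd ℝ _ _ ∘ₗ tractorSubtype p x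

/-- The canonical inclusion `X : 𝓔(-1) → 𝒯`. -/
def inclX (x : M) : Density n x (-1) →ₗ[ℝ] Tractor p x :=
  LinearMap.codRestrict (tractorSubmodule p x)
    (LinearMap.prod 0 (LinearMap.pi fun _ ↦ LinearMap.id))
    (by intro τ D D' Υ _ b; simp)

/-! ### Local tractor frames and the tractor connection

A scale `∇` and a local frame `s_1, …, s_{n+1}` of the tangent bundle give a local frame of the
tractor bundle, with indices in `Fin (n + 1) ⊕ Unit`: the vectors `W(s_j)`, and `X`, where the
weights are removed by means of the density that takes the value `1` on the frame `s`. -/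

section Frame

variable {p}
variable (D : p.carrier) {s : Fin (n + 1) → ∀ x : M, TangentSpace (𝓡 (n + 1)) x} {u : Set M}
  (hs : IsLocalFrameOn (𝓡 (n + 1)) (Model n) ∞ s u)

/-- The dual tractor frame: the components of a tractor in the scale `D` and the frame `s`. -/
def dualFrame (y : M) : Fin (n + 1) ⊕ Unit → Module.Dual ℝ (Tractor p y)
  | .inl i => hs.coeff i y ∘ₗ LinearMap.proj (fun j ↦ s j y) ∘ₗ (Submodule.subtype _) ∘ₗ
      projZ p y
  | .inr _ => LinearMap.proj (fun j ↦ s j y) ∘ₗ (Submodule.subtype _) ∘ₗ projY p D y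

/-- The connection form `ω^i_j(v)` of the affine connection, `∇_v s_j = ω^i_j(v) s_i`. -/
def connForm (x : M) (v : TangentSpace (𝓡 (n + 1)) x) : Matrix (Fin (n + 1)) (Fin (n + 1)) ℝ :=
  Matrix.of fun i j ↦ hs.coeff i x (D.1 (s j) x v)

/-- The connection form of the normal tractor connection in the tractor frame, from
`∇_a X = W_a` and `∇_a W_b = -P_{ab} X`.  A density `φ` of weight `w` has
`(∇_v φ)(s) = v(φ(s)) + (w / (n + 2)) tr ω(v) φ(s)`, which gives the trace terms with `w = -1`. -/
def tractorConnForm (x : M) (v : TangentSpace (𝓡 (n + 1)) x) :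
    Matrix (Fin (n + 1) ⊕ Unit) (Fin (n + 1) ⊕ Unit) ℝ :=
  Matrix.fromBlocks
    (connForm D hs x v) (Matrix.of fun i _ ↦ hs.coeff i x v)
    (Matrix.of fun _ j ↦ -schouten D.1 x v (s j x)) 0
  - ((connForm D hs x v).trace / ((n : ℝ) + 2)) • (1 : Matrix _ _ ℝ)

/-- The component functions `t^A` of a tractor field. -/
def tractorComp (t : ∀ x : M, Tractor p x) (A : Fin (n + 1) ⊕ Unit) (y : M) : ℝ :=
  dualFrame D hs y A (t y)

/-- The component functions `H^{AB}` of a contravariant tractor two-tensor. -/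
def tractorComp₂ (H : ∀ x : M, LinearMap.BilinForm ℝ (Module.Dual ℝ (Tractor p x)))
    (A B : Fin (n + 1) ⊕ Unit) (y : M) : ℝ :=
  H y (dualFrame D hs y A) (dualFrame D hs y B)

end Frame

/-- A tractor field is smooth: its components in all scales and smooth local frames are. -/
def IsSmoothTractor (t : ∀ x : M, Tractor p x) : Prop :=
  ∀ (D : p.carrier) (s : Fin (n + 1) → ∀ x : M, TangentSpace (𝓡 (n + 1)) x) (u : Set M)
    (hs : IsLocalFrameOn (𝓡 (n + 1)) (Model n) ∞ s u), IsOpen u →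
    ∀ A, ContMDiffOn (𝓡 (n + 1)) 𝓘(ℝ, ℝ) ∞ (tractorComp D hs t A) u

/-- `∇_c t^A = 0` for the tractor connection: `v(t^A) + 𝒜^A_B(v) t^B = 0`. -/
def IsParallelTractor (t : ∀ x : M, Tractor p x) : Prop :=
  ∀ (D : p.carrier) (s : Fin (n + 1) → ∀ x : M, TangentSpace (𝓡 (n + 1)) x) (u : Set M)
    (hs : IsLocalFrameOn (𝓡 (n + 1)) (Model n) ∞ s u), IsOpen u →
    ∀ x ∈ u, ∀ (v : TangentSpace (𝓡 (n + 1)) x) (A : Fin (n + 1) ⊕ Unit),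
      mvfderiv (𝓡 (n + 1)) (tractorComp D hs t A) x v
        + ∑ B, tractorConnForm D hs x v A B * tractorComp D hs t B x = 0

/-- A contravariant tractor two-tensor field is smooth. -/
def IsSmoothTractorForm
    (H : ∀ x : M, LinearMap.BilinForm ℝ (Module.Dual ℝ (Tractor p x))) : Prop :=
  ∀ (D : p.carrier) (s : Fin (n + 1) → ∀ x : M, TangentSpace (𝓡 (n + 1)) x) (u : Set M)
    (hs : IsLocalFrameOn (𝓡 (n + 1)) (Model n) ∞ s u), IsOpen u →
    ∀ A B, ContMDiffOn (𝓡 (n + 1)) 𝓘(ℝ, ℝ) ∞ (tractorComp₂ D hs H A B) u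

/-- `∇_c H^{AB} = 0` for the tractor connection:
`v(H^{AB}) + 𝒜^A_C(v) H^{CB} + 𝒜^B_C(v) H^{AC} = 0`. -/
def IsParallelTractorForm
    (H : ∀ x : M, LinearMap.BilinForm ℝ (Module.Dual ℝ (Tractor p x))) : Prop :=
  ∀ (D : p.carrier) (s : Fin (n + 1) → ∀ x : M, TangentSpace (𝓡 (n + 1)) x) (u : Set M)
    (hs : IsLocalFrameOn (𝓡 (n + 1)) (Model n) ∞ s u), IsOpen u →
    ∀ x ∈ u, ∀ (v : TangentSpace (𝓡 (n + 1)) x) (A B : Fin (n + 1) ⊕ Unit),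
      mvfderiv (𝓡 (n + 1)) (tractorComp₂ D hs H A B) x v
        + ∑ C, tractorConnForm D hs x v A C * tractorComp₂ D hs H C B x
        + ∑ C, tractorConnForm D hs x v B C * tractorComp₂ D hs H A C x = 0

/-! ### The distinguished densities and the pieces of the decomposition -/

variable {p}
variable (H : ∀ x : M, LinearMap.BilinForm ℝ (Module.Dual ℝ (Tractor p x)))
  (I : ∀ x : M, Tractor p x)

/-- The pointwise inverse `Φ_{AB}` of `H^{AB}`. -/
def Phi (x : M) : LinearMap.BilinForm ℝ (Tractor p x) := inverseForm (H x)

/-- `σ = Φ_{AB} I^A X^B`, a density of weight `1`, as a linear form on `𝓔(-1)`. -/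
def sigma (x : M) : Density n x (-1) →ₗ[ℝ] ℝ := Phi H x (I x) ∘ₗ inclX p x

/-- `λ = Φ_{AB} X^A X^B`, a density of weight `2`, as a bilinear form on the line `𝓔(-1)`. -/
def lam (x : M) : LinearMap.BilinForm ℝ (Density n x (-1)) :=
  (Phi H x).compl₁₂ (inclX p x) (inclX p x)

/-- `𝒵(n)`, the zero set of `n^a = Z^a_A I^A`. -/
def zeroN : Set M := {x | projZ p x (I x) = 0}

/-- `𝒵(σ)`. -/
def zeroSigma : Set M := {x | sigma H I x = 0}

/-- `𝒵(λ)`. -/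
def zeroLam : Set M := {x | lam H x = 0}

/-- `{λ > 0}`. -/
def posLam : Set M := {x | ∀ τ, τ ≠ 0 → 0 < lam H x τ τ}

/-- `{λ < 0}`. -/
def negLam : Set M := {x | ∀ τ, τ ≠ 0 → lam H x τ τ < 0}

/-- `𝒪 = {σ ≠ 0}`. -/
def orbitO : Set M := {x | sigma H I x ≠ 0}

/-- `Σ = 𝒵(σ) ∖ 𝒵(n)`. -/
def orbitSigma : Set M := zeroSigma H I \ zeroN I

/-- `Σ⁻ = 𝒵(σ) ∩ {λ < 0}`. -/
def orbitSigmaNeg : Set M := zeroSigma H I ∩ negLam H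

/-- `Σ⁺ = 𝒵(σ) ∩ {λ > 0}`. -/
def orbitSigmaPos : Set M := zeroSigma H I ∩ posLam H

/-- `Σ⁰ = (𝒵(σ) ∩ 𝒵(λ)) ∖ 𝒵(n)`. -/
def orbitSigmaZero : Set M := (zeroSigma H I ∩ zeroLam H) \ zeroN I

/-- `S` is a smooth embedded submanifold of codimension `k`: around each of its points there is a
smooth chart in which `S` is given by the vanishing of the first `k` coordinates. -/
def IsEmbeddedSubmanifold (n : ℕ) {M : Type*} [TopologicalSpace M] [ChartedSpace (Model n) M]
    (k : ℕ) (S : Set M) : Prop :=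
  k ≤ n + 1 ∧ ∀ x ∈ S, ∃ φ ∈ IsManifold.maximalAtlas (𝓡 (n + 1)) ∞ M, x ∈ φ.source ∧
    ∀ y ∈ φ.source, y ∈ S ↔ ∀ i : Fin (n + 1), (i : ℕ) < k → φ y i = 0

end Manifold

end ProjTractor

end

/-!
# The decomposition of a projective manifold by a parallel null tractor

Fix a scale and a local frame of the tangent bundle. A tractor then has components indexed by
`Fin (n + 1) ⊕ Unit`, the form `H` becomes an invertible symmetric matrix, and `σ` and `λ` become
the functions `Φ_{AB} I^A X^B` and `Φ_{AB} X^A X^B`, where `X` is the last basis vector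
(`sigma_apply`, `lam_apply`). All that is used of the tractor connection is that `∇_c X = W_c` up to
a multiple of `X`, so the curvature terms play no part.

* Where `n` vanishes, `I` is a nonzero multiple `ρ X`, and `∇_c n^a = -ρ δ_c^a` is invertible; hence
  the zeros of `n` are isolated, and finite in number by compactness. As `I` is null, `λ` vanishes
  at these points, and so does `σ = ρ λ` (`zeroN_subset`).
* Since `H` is parallel, so are `Φ` and `Φ_{AB} I^A` (`mvfderiv_tractorGram_inv`,
  `mvfderiv_lowered`). Where `σ` vanishes, its differential is therefore `Φ_{AB} I^A W_c^B`; if this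
  vanished too, `Φ_{AB} I^A` would be zero, contrary to `I ≠ 0`. So `𝒵(σ)` is a hypersurface, of
  which `Σ`, `Σ⁻` and `Σ⁺` are open subsets.
* Where both `σ` and `λ` vanish, the differential of `λ` is `2 Φ_{AB} X^A W_c^B`. A linear relation
  `a dσ + b dλ = 0` forces `a I + 2 b X = 0`, so `a n = 0`, and away from the zeros of `n` this gives
  `a = b = 0` (`linearIndependent_mvfderiv_sigma_lam`). So `Σ⁰` has codimension two.

In each case functions with linearly independent differentials are completed to a chart by the
inverse function theorem (`exists_chart_of_linearIndependent`).
-/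

noncomputable section

namespace ProjTractor

/-! ### Charts adapted to functions with independent differentials -/

theorem exists_linearIndependent_extension {V : Type*} [AddCommGroup V] [Module ℝ V]
    {k m : ℕ} (hkm : k ≤ m) (hm : m ≤ Module.finrank ℝ V) {L : Fin k → V}
    (hL : LinearIndependent ℝ L) :
    ∃ L' : Fin m → V, LinearIndependent ℝ L' ∧ ∀ i, L' (Fin.castLE hkm i) = L i := by
  induction m, hkm using Nat.le_induction with
  | base => exact ⟨L, hL, fun i ↦ rfl⟩
  | succ m hkm ih =>
    obtain ⟨L', h1, h2⟩ := ih (by omega)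
    obtain ⟨z, hz⟩ := exists_linearIndependent_snoc_of_lt_finrank h1 (by omega)
    refine ⟨Fin.snoc L' z, hz, fun i ↦ ?_⟩
    have : Fin.castLE (Nat.le_succ_of_le hkm) i = Fin.castSucc (Fin.castLE hkm i) := rfl
    rw [this, Fin.snoc_castSucc, h2]

theorem eq_zero_of_forall_linearIndependent_dual {V : Type*} [AddCommGroup V] [Module ℝ V]
    [FiniteDimensional ℝ V] {ι : Type*} [Fintype ι] {L : ι → Module.Dual ℝ V}
    (hL : LinearIndependent ℝ L) (hc : Fintype.card ι = Module.finrank ℝ V) {v : V}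
    (hv : ∀ i, L i v = 0) : v = 0 := by
  have hspan : Submodule.span ℝ (Set.range L) = ⊤ :=
    hL.span_eq_top_of_card_eq_finrank' (by rw [hc, Subspace.dual_finrank_eq])
  rw [← Module.forall_dual_apply_eq_zero_iff ℝ]
  intro φ
  have hφ : φ ∈ Submodule.span ℝ (Set.range L) := hspan ▸ Submodule.mem_top
  induction hφ using Submodule.span_induction with
  | mem x hx => obtain ⟨i, rfl⟩ := hx; exact hv i
  | zero => rfl
  | add x y _ _ hx hy => simp [hx, hy]
  | smul a x _ hx => simp [hx]

/-- The inverse function theorem for the groupoid of smooth local diffeomorphisms. -/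
theorem exists_mem_contDiffGroupoid_of_hasFDerivAt {E : Type*} [NormedAddCommGroup E]
    [NormedSpace ℝ E] [CompleteSpace E] {F : E → E} {U : Set E} (hU : IsOpen U) {a : E}
    (ha : a ∈ U) (hF : ContDiffOn ℝ ∞ F U) {F' : E ≃L[ℝ] E}
    (hF' : HasFDerivAt F (F' : E →L[ℝ] E) a) :
    ∃ ψ ∈ contDiffGroupoid ∞ 𝓘(ℝ, E), a ∈ ψ.source ∧ ψ.source ⊆ U ∧ ∀ z, ψ z = F z := by
  have hFa : ContDiffAt ℝ ∞ F a := hF.contDiffAt (hU.mem_nhds ha)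
  let ψ₀ := hFa.toOpenPartialHomeomorph F hF' (by simp)
  have hd : ContinuousOn (fderiv ℝ F) U := hF.continuousOn_fderiv_of_isOpen hU (by simp)
  -- the differential stays invertible near `a`, which makes the inverse smooth near `F a`
  let V : Set E := U ∩ fderiv ℝ F ⁻¹' Set.range ((↑) : (E ≃L[ℝ] E) → E →L[ℝ] E)
  have hV : IsOpen V := hd.isOpen_inter_preimage hU (ContinuousLinearEquiv.isOpen ..)
  have haV : a ∈ V := ⟨ha, F', hF'.fderiv.symm⟩
  refine ⟨ψ₀.restrOpen V hV, ?_, ⟨hFa.mem_toOpenPartialHomeomorph_source hF' (by simp), haV⟩,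
    fun z hz ↦ hz.2.1, fun z ↦ rfl⟩
  rw [contDiffGroupoid, mem_groupoid_of_pregroupoid]
  constructor
  · have : ContDiffOn ℝ ∞ F (ψ₀.restrOpen V hV).source := hF.mono fun z hz ↦ hz.2.1
    simpa [contDiffPregroupoid] using! this
  · have : ContDiffOn ℝ ∞ (ψ₀.restrOpen V hV).symm (ψ₀.restrOpen V hV).target := by
      intro y hy
      have hz : (ψ₀.restrOpen V hV).symm y ∈ V :=
        ((ψ₀.restrOpen V hV).map_target hy).2
      obtain ⟨G, hG⟩ := hz.2
      have hc := hF.contDiffAt (hU.mem_nhds hz.1)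
      have hG' : HasFDerivAt F (G : E →L[ℝ] E) ((ψ₀.restrOpen V hV).symm y) := by
        rw [hG]; exact (hc.differentiableAt (by simp)).hasFDerivAt
      exact ((ψ₀.restrOpen V hV).contDiffAt_symm hy hG' hc).contDiffWithinAt
    simpa [contDiffPregroupoid] using! this

section Chart

variable {n : ℕ} {M : Type*} [TopologicalSpace M] [ChartedSpace (Model n) M]

theorem trans_mem_maximalAtlas {e : OpenPartialHomeomorph M (Model n)}
    (he : e ∈ IsManifold.maximalAtlas (𝓡 (n + 1)) ∞ M)
    {ψ : OpenPartialHomeomorph (Model n) (Model n)}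
    (hψ : ψ ∈ contDiffGroupoid ∞ (𝓡 (n + 1))) :
    e.trans ψ ∈ IsManifold.maximalAtlas (𝓡 (n + 1)) ∞ M := by
  intro c hc
  obtain ⟨h1, h2⟩ := he c hc
  constructor
  · rw [OpenPartialHomeomorph.trans_symm_eq_symm_trans_symm, OpenPartialHomeomorph.trans_assoc]
    exact (contDiffGroupoid ∞ _).trans ((contDiffGroupoid ∞ _).symm hψ) h1
  · rw [← OpenPartialHomeomorph.trans_assoc]
    exact (contDiffGroupoid ∞ _).trans h2 hψ

/-- The points of an embedded submanifold of dimension `0` are isolated. -/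
theorem IsEmbeddedSubmanifold.exists_isOpen_inter_eq_singleton {S : Set M}
    (hS : IsEmbeddedSubmanifold n (n + 1) S) {x : M} (hx : x ∈ S) :
    ∃ U : Set M, IsOpen U ∧ U ∩ S = {x} := by
  obtain ⟨φ, -, hxφ, hφ⟩ := hS.2 x hx
  refine ⟨φ.source, φ.open_source, Set.eq_singleton_iff_unique_mem.2 ⟨⟨hxφ, hx⟩, ?_⟩⟩
  rintro y ⟨hyφ, hy⟩
  refine φ.injOn hyφ hxφ ?_
  ext i
  rw [(hφ y hyφ).1 hy i i.2, (hφ x hxφ).1 hx i i.2]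

variable [IsManifold (𝓡 (n + 1)) ∞ M]

/-- Smooth functions whose differentials at `x` are linearly independent are the first coordinates
of a smooth chart around `x`. -/
theorem exists_chart_of_linearIndependent {k : ℕ} {g : Fin k → M → ℝ} {U : Set M}
    (hU : IsOpen U) {x : M} (hx : x ∈ U)
    (hg : ∀ i, ContMDiffOn (𝓡 (n + 1)) 𝓘(ℝ, ℝ) ∞ (g i) U)
    (hli : LinearIndependent ℝ fun i ↦ mvfderiv (𝓡 (n + 1)) (g i) x) :
    ∃ hk : k ≤ n + 1, ∃ φ ∈ IsManifold.maximalAtlas (𝓡 (n + 1)) ∞ M, x ∈ φ.source ∧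
      φ.source ⊆ U ∧ ∀ y ∈ φ.source, ∀ i, φ y (Fin.castLE hk i) = g i y := by
  let e := chartAt (Model n) x
  have he : e ∈ IsManifold.maximalAtlas (𝓡 (n + 1)) ∞ M := IsManifold.chart_mem_maximalAtlas x
  let L : Fin k → Model n →L[ℝ] ℝ := fun i ↦ mvfderiv (𝓡 (n + 1)) (g i) x
  have hL : LinearIndependent ℝ L := hli
  have hfin : Module.finrank ℝ (Model n →L[ℝ] ℝ) = n + 1 := by
    rw [← (LinearMap.toContinuousLinearMap (𝕜 := ℝ) (E := Model n) (F' := ℝ)).finrank_eq,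
      Subspace.dual_finrank_eq (V := Model n)]
    simp
  have hk : k ≤ n + 1 := by simpa [hfin] using hL.fintype_card_le_finrank
  obtain ⟨L', hL', hLL⟩ := exists_linearIndependent_extension hk hfin.ge hL
  let W : Set (Model n) := e.target ∩ e.symm ⁻¹' U
  have hW : IsOpen W := e.isOpen_inter_preimage_symm hU
  have hxe : x ∈ e.source := mem_chart_source _ x
  have hxW : e x ∈ W := ⟨e.map_source hxe, by simpa [e.left_inv hxe] using hx⟩
  have hgW : ∀ i, ContDiffOn ℝ ∞ (g i ∘ e.symm) W := by
    intro i
    rw [← contMDiffOn_iff_contDiffOn]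
    exact (hg i).comp ((contMDiffOn_symm_of_mem_maximalAtlas he).mono Set.inter_subset_left)
      fun z hz ↦ hz.2
  have hgd : ∀ i, HasFDerivAt (g i ∘ e.symm) (L i) (e x) := by
    intro i
    have h1 : MDifferentiableAt (𝓡 (n + 1)) 𝓘(ℝ, ℝ) (g i) x :=
      ((hg i).contMDiffAt (hU.mem_nhds hx)).mdifferentiableAt (by simp)
    have h2 := h1.mvfderiv
    have h3 : L i = fderiv ℝ (g i ∘ e.symm) (e x) := by
      rw [show L i = _ from h2]
      simp [writtenInExtChartAt, extChartAt, e, fderivWithin_univ]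
      rfl
    rw [h3]
    exact (((hgW i).contDiffAt (hW.mem_nhds hxW)).differentiableAt (by simp)).hasFDerivAt
  -- the functions `g i`, completed by linear functions of the coordinates of the chart `e`
  let F : Model n → Model n := fun z ↦ WithLp.toLp 2 fun j ↦
    if h : (j : ℕ) < k then g ⟨j, h⟩ (e.symm z) else L' j z
  let F' : Model n →ₗ[ℝ] Model n :=
    (WithLp.linearEquiv 2 ℝ (Fin (n + 1) → ℝ)).symm.toLinearMap ∘ₗ
      LinearMap.pi fun j ↦ (L' j : Model n →ₗ[ℝ] ℝ)
  have hinj : Function.Injective F' := by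
    rw [injective_iff_map_eq_zero]
    intro v hv
    have hL'' : LinearIndependent ℝ fun j ↦ (L' j : Module.Dual ℝ (Model n)) :=
      hL'.map' (LinearMap.toContinuousLinearMap (𝕜 := ℝ) (E := Model n) (F' := ℝ)).symm.toLinearMap
        (LinearEquiv.ker _)
    refine eq_zero_of_forall_linearIndependent_dual hL'' (by simp) fun j ↦ ?_
    have := congrArg (fun w : Model n ↦ w j) hv
    simpa [F'] using this
  let F'e : Model n ≃L[ℝ] Model n := (LinearEquiv.ofInjectiveEndo F' hinj).toContinuousLinearEquiv
  have hF : ContDiffOn ℝ ∞ F W := by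
    rw [contDiffOn_euclidean]
    intro j
    by_cases h : (j : ℕ) < k
    · simpa [F, h] using! hgW ⟨j, h⟩
    · simpa [F, h] using! (L' j).contDiff.contDiffOn
  have hF' : HasFDerivAt F (F'e : Model n →L[ℝ] Model n) (e x) := by
    rw [← hasFDerivWithinAt_univ, hasFDerivWithinAt_euclidean]
    simp only [hasFDerivWithinAt_univ]
    intro j
    have hj : (PiLp.proj 2 (fun _ : Fin (n + 1) ↦ ℝ) j : _ →L[ℝ] ℝ) ∘L
        (F'e : Model n →L[ℝ] Model n) = L' j := by
      ext v; rfl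
    by_cases h : (j : ℕ) < k
    · have h1 : L' j = L ⟨j, h⟩ := hLL ⟨j, h⟩
      have h2 := hgd ⟨j, h⟩
      rw [← h1, ← hj] at h2
      simpa [F, h] using! h2
    · have h2 : HasFDerivAt (L' j) (L' j) (e x) := (L' j).hasFDerivAt
      rw [← hj] at h2
      simpa [F, h] using! h2
  obtain ⟨ψ, hψ, hxψ, hψW, hψF⟩ := exists_mem_contDiffGroupoid_of_hasFDerivAt hW hxW hF hF'
  refine ⟨hk, e.trans ψ, trans_mem_maximalAtlas he hψ, ?_, ?_, ?_⟩
  · simp [hxψ, hxe]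
  · intro y hy
    rw [OpenPartialHomeomorph.trans_source] at hy
    have := (hψW hy.2).2
    simpa [e.left_inv hy.1] using this
  · intro y hy i
    rw [OpenPartialHomeomorph.trans_source] at hy
    rw [OpenPartialHomeomorph.trans_apply, hψF]
    simp [F, e.left_inv hy.1]

/-- A set that is locally the common zero set of `k` smooth functions with linearly independent
differentials is an embedded submanifold of codimension `k`.  The bound on `k` is only
informative for the empty set. -/
theorem isEmbeddedSubmanifold_of_linearIndependent {k : ℕ} (hk : k ≤ n + 1) {S : Set M}
    (h : ∀ x ∈ S, ∃ U : Set M, IsOpen U ∧ x ∈ U ∧ ∃ g : Fin k → M → ℝ,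
      (∀ i, ContMDiffOn (𝓡 (n + 1)) 𝓘(ℝ, ℝ) ∞ (g i) U) ∧
      (LinearIndependent ℝ fun i ↦ mvfderiv (𝓡 (n + 1)) (g i) x) ∧
      ∀ y ∈ U, y ∈ S ↔ ∀ i, g i y = 0) :
    IsEmbeddedSubmanifold n k S := by
  refine ⟨hk, fun x hx ↦ ?_⟩
  obtain ⟨U, hU, hxU, g, hg, hli, hS⟩ := h x hx
  obtain ⟨_, φ, hφ, hxφ, hφU, hφg⟩ := exists_chart_of_linearIndependent hU hxU hg hli
  refine ⟨φ, hφ, hxφ, fun y hy ↦ ?_⟩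
  rw [hS y (hφU hy)]
  constructor
  · intro h0 i hi
    rw [← h0 ⟨i, hi⟩, ← hφg y hy ⟨i, hi⟩]
    rfl
  · intro h0 i
    rw [← hφg y hy i]
    exact h0 _ i.2

end Chart

/-! ### Forms with a signature -/

section Signature

variable {W : Type*} [AddCommGroup W] [Module ℝ W] {H : LinearMap.BilinForm ℝ W} {q p : ℕ}

theorem HasSignature.apply_comm (h : HasSignature H q p) (a b : W) : H a b = H b a := by
  obtain ⟨e, he⟩ := h
  have : H = H.flip := by
    refine LinearMap.BilinForm.ext_basis e fun i j ↦ ?_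
    rw [LinearMap.BilinForm.flip_apply, he, he]
    by_cases hij : i = j
    · simp [hij]
    · simp [hij, Ne.symm hij]
  exact (DFunLike.congr_fun (DFunLike.congr_fun this a) b).trans
    (LinearMap.BilinForm.flip_apply ..)

theorem HasSignature.nondegenerate (h : HasSignature H q p) : H.Nondegenerate := by
  have hsep : ∀ a, (∀ b, H a b = 0) → a = 0 := by
    obtain ⟨e, he⟩ := h
    intro a ha
    refine e.ext_elem fun i ↦ ?_
    have h1 : H a (e i) = e.repr a i * H (e i) (e i) := by
      conv_lhs => rw [← e.sum_repr a]
      rw [map_sum, LinearMap.sum_apply, Finset.sum_eq_single i]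
      · simp
      · intro j _ hj
        simp [he, hj]
      · simp
    rw [ha, he, if_pos rfl] at h1
    rcases i with i | i <;> simpa using h1.symm
  exact ⟨hsep, fun a ha ↦ hsep a fun b ↦ by rw [h.apply_comm]; exact ha b⟩

theorem HasSignature.finrank_eq (h : HasSignature H q p) : Module.finrank ℝ W = q + p := by
  obtain ⟨e, -⟩ := h
  simp [Module.finrank_eq_card_basis e]

end Signature

/-! ### Smoothness and derivatives of matrix entries -/

section Calculus

theorem contDiff_matrix_det {ι E : Type*} [Fintype ι] [DecidableEq ι] [NormedAddCommGroup E]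
    [NormedSpace ℝ E] {A : E → Matrix ι ι ℝ} (hA : ∀ i j, ContDiff ℝ ∞ fun z ↦ A z i j) :
    ContDiff ℝ ∞ fun z ↦ (A z).det := by
  simp only [Matrix.det_apply]
  exact ContDiff.sum fun σ _ ↦ (contDiff_prod fun i _ ↦ hA _ _).const_smul _

variable {n : ℕ} {M : Type*} [TopologicalSpace M] [ChartedSpace (Model n) M]

theorem contMDiffOn_matrix_inv_apply {ι : Type*} [Fintype ι] [DecidableEq ι] {u : Set M}
    {A : M → Matrix ι ι ℝ} (hA : ∀ i j, ContMDiffOn (𝓡 (n + 1)) 𝓘(ℝ, ℝ) ∞ (fun y ↦ A y i j) u)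
    (hdet : ∀ y ∈ u, (A y).det ≠ 0) (i j : ι) :
    ContMDiffOn (𝓡 (n + 1)) 𝓘(ℝ, ℝ) ∞ (fun y ↦ (A y)⁻¹ i j) u := by
  have hpi : ContMDiffOn (𝓡 (n + 1)) 𝓘(ℝ, ι → ι → ℝ) ∞ (fun y i j ↦ A y i j) u :=
    contMDiffOn_pi_space.2 fun i ↦ contMDiffOn_pi_space.2 fun j ↦ hA i j
  have hd : ContDiff ℝ ∞ fun a : ι → ι → ℝ ↦ (Matrix.of a).det :=
    contDiff_matrix_det fun i j ↦ by simp only [Matrix.of_apply]; fun_prop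
  have ha : ContDiff ℝ ∞ fun a : ι → ι → ℝ ↦ (Matrix.of a).adjugate i j := by
    simp only [Matrix.adjugate_apply]
    refine contDiff_matrix_det fun k l ↦ ?_
    by_cases hk : k = j
    · subst hk
      simpa using contDiff_const
    · simp only [Matrix.updateRow_ne hk, Matrix.of_apply]
      fun_prop
  have h1 : ContMDiffOn (𝓡 (n + 1)) 𝓘(ℝ, ℝ) ∞ (fun y ↦ (A y).det) u := hd.contMDiff.comp_contMDiffOn hpi
  have h2 : ContMDiffOn (𝓡 (n + 1)) 𝓘(ℝ, ℝ) ∞ (fun y ↦ (A y).adjugate i j) u :=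
    ha.contMDiff.comp_contMDiffOn hpi
  refine ((h1.inv₀ hdet).mul h2).congr fun y _ ↦ ?_
  simp [Matrix.inv_def]

theorem contMDiffOn_sum_mul {ι : Type*} [Fintype ι] {u : Set M} {a b : ι → M → ℝ}
    (ha : ∀ i, ContMDiffOn (𝓡 (n + 1)) 𝓘(ℝ, ℝ) ∞ (a i) u)
    (hb : ∀ i, ContMDiffOn (𝓡 (n + 1)) 𝓘(ℝ, ℝ) ∞ (b i) u) :
    ContMDiffOn (𝓡 (n + 1)) 𝓘(ℝ, ℝ) ∞ (fun y ↦ ∑ i, a i y * b i y) u := by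
  have hpa := contMDiffOn_pi_space.2 ha
  have hpb := contMDiffOn_pi_space.2 hb
  have h : ContDiff ℝ ∞ fun z : (ι → ℝ) × (ι → ℝ) ↦ ∑ i, z.1 i * z.2 i := by fun_prop
  exact h.contMDiff.comp_contMDiffOn (hpa.prodMk_space hpb)

theorem mvfderiv_sum_mul {ι : Type*} (S : Finset ι) {x : M} {a b : ι → M → ℝ}
    (ha : ∀ i, MDifferentiableAt (𝓡 (n + 1)) 𝓘(ℝ, ℝ) (a i) x)
    (hb : ∀ i, MDifferentiableAt (𝓡 (n + 1)) 𝓘(ℝ, ℝ) (b i) x)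
    (v : TangentSpace (𝓡 (n + 1)) x) :
    mvfderiv (𝓡 (n + 1)) (fun y ↦ ∑ i ∈ S, a i y * b i y) x v =
      ∑ i ∈ S, (mvfderiv (𝓡 (n + 1)) (a i) x v * b i x + a i x * mvfderiv (𝓡 (n + 1)) (b i) x v) := by
  classical
  have hab : ∀ i, MDifferentiableAt (𝓡 (n + 1)) 𝓘(ℝ, ℝ) (fun y ↦ a i y * b i y) x :=
    fun i ↦ (ha i).mul (hb i)
  have key : MDifferentiableAt (𝓡 (n + 1)) 𝓘(ℝ, ℝ) (fun y ↦ ∑ i ∈ S, a i y * b i y) x ∧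
      mvfderiv (𝓡 (n + 1)) (fun y ↦ ∑ i ∈ S, a i y * b i y) x v = ∑ i ∈ S,
        (mvfderiv (𝓡 (n + 1)) (a i) x v * b i x + a i x * mvfderiv (𝓡 (n + 1)) (b i) x v) := by
    induction S using Finset.induction_on with
    | empty => simpa using! ⟨mdifferentiableAt_const, by simp [mvfderiv_const]⟩
    | insert i S hi ih =>
      simp only [Finset.sum_insert hi]
      refine ⟨(hab i).add ih.1, ?_⟩
      rw [mvfderiv_fun_add (hab i) ih.1, mvfderiv_fun_mul (ha i) (hb i)]
      simp [ih.2]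
      ring
  exact key.2

end Calculus

/-! ### Tractor frames -/

theorem Weighted.eq_zero_of_apply_basis {n : ℕ} {T V : Type*} [AddCommGroup T] [Module ℝ T]
    [AddCommGroup V] [Module ℝ V] {w : ℝ} {φ : Weighted n T V w}
    (B : Module.Basis (Fin (n + 1)) ℝ T) (h : φ.1 B = 0) : φ = 0 := by
  refine Subtype.ext (funext fun b ↦ ?_)
  by_cases hb : LinearIndependent ℝ b
  · have : Module.Finite ℝ T := Module.Finite.of_basis B
    let B' : Module.Basis (Fin (n + 1)) ℝ T := basisOfLinearIndependentOfCardEqFinrank hb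
      (by simp [Module.finrank_eq_card_basis B])
    have h1 := φ.2.2 (B.equiv B' (Equiv.refl _)) B
    have h2 : (fun i ↦ B.equiv B' (Equiv.refl _) (B i)) = b := by
      funext i
      simp [B']
    rw [h2, h, smul_zero] at h1
    exact h1
  · exact φ.2.1 b hb

section Frame

variable {n : ℕ} {M : Type*} [TopologicalSpace M] [ChartedSpace (Model n) M]
  [IsManifold (𝓡 (n + 1)) ∞ M] {p : ProjectiveStructure n M}
  (D : p.carrier) {s : Fin (n + 1) → ∀ x : M, TangentSpace (𝓡 (n + 1)) x} {u : Set M}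
  (hs : IsLocalFrameOn (𝓡 (n + 1)) (Model n) ∞ s u) {y : M}

variable (n) in
theorem exists_isLocalFrameOn (x : M) :
    ∃ (s : Fin (n + 1) → ∀ x : M, TangentSpace (𝓡 (n + 1)) x) (u : Set M),
      IsLocalFrameOn (𝓡 (n + 1)) (Model n) ∞ s u ∧ IsOpen u ∧ x ∈ u := by
  let e := trivializationAt (Model n) (TangentSpace (𝓡 (n + 1)) : M → Type _) x
  exact ⟨_, e.baseSet, e.isLocalFrameOn_localFrame_baseSet (𝓡 (n + 1)) ∞
    (EuclideanSpace.basisFun (Fin (n + 1)) ℝ).toBasis, e.open_baseSet,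
    mem_baseSet_trivializationAt _ _ x⟩

theorem forall_coeff_eq_zero_iff (hy : y ∈ u) {v : TangentSpace (𝓡 (n + 1)) y} :
    (∀ i, hs.coeff i y v = 0) ↔ v = 0 := by
  refine ⟨fun h ↦ (hs.toBasisAt hy).ext_elem fun i ↦ ?_, fun h i ↦ by rw [h, map_zero]⟩
  have := h i
  simp only [IsLocalFrameOn.coeff, hy, dif_pos] at this
  simpa using! this

theorem coe_toBasisAt (hy : y ∈ u) : ⇑(hs.toBasisAt hy) = fun j ↦ s j y :=
  funext fun j ↦ hs.toBasisAt_coe hy j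

theorem projZ_eq_zero_iff (hy : y ∈ u) {t : Tractor p y} :
    projZ p y t = 0 ↔ ∀ i, dualFrame D hs y (.inl i) t = 0 := by
  refine ⟨fun h i ↦ by simp [dualFrame, h], fun h ↦ ?_⟩
  refine Weighted.eq_zero_of_apply_basis (hs.toBasisAt hy) ?_
  rw [coe_toBasisAt]
  exact (forall_coeff_eq_zero_iff hs hy).1 h

theorem eq_zero_of_dualFrame_eq_zero (hy : y ∈ u) {t : Tractor p y}
    (h : ∀ A, dualFrame D hs y A t = 0) : t = 0 := by
  have h1 : projZ p y t = 0 := (projZ_eq_zero_iff D hs hy).2 fun i ↦ h _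
  have h2 : projY p D y t = 0 := by
    refine Weighted.eq_zero_of_apply_basis (hs.toBasisAt hy) ?_
    rw [coe_toBasisAt]
    exact h (.inr ())
  refine Subtype.ext (Prod.ext h1 (funext fun D' ↦ Subtype.ext (funext fun b ↦ ?_)))
  obtain ⟨-, -, Υ, hΥ⟩ := (p.mem_iff D.1 D.2 D'.1).1 D'.2
  have h3 := t.2 D D' Υ hΥ b
  have h4 : t.1.1 = 0 := h1
  have h5 : t.1.2 D = 0 := h2
  rw [h4, h5] at h3
  simpa using! h3

/-- The covectors of the tractor coframe separate points, so they form a basis as soon as the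
dimension of the fibre is known; a form of signature `(2, n)` on the dual provides it. -/
theorem exists_basis_coord_eq_dualFrame (hy : y ∈ u)
    (hdim : Module.finrank ℝ (Module.Dual ℝ (Tractor p y)) = 2 + n) :
    ∃ e : Module.Basis (Fin (n + 1) ⊕ Unit) ℝ (Tractor p y),
      ∀ A, e.coord A = dualFrame D hs y A := by
  have hdim' : Module.finrank ℝ (Tractor p y) = 2 + n := by
    rw [← hdim, Subspace.dual_finrank_eq]
  have hfin : FiniteDimensional ℝ (Tractor p y) :=
    Module.finite_of_finrank_pos (by omega)
  let E : Tractor p y →ₗ[ℝ] (Fin (n + 1) ⊕ Unit → ℝ) := LinearMap.pi (dualFrame D hs y)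
  have hE : Function.Injective E := (injective_iff_map_eq_zero E).2 fun t ht ↦
    eq_zero_of_dualFrame_eq_zero D hs hy fun A ↦ congrFun ht A
  refine ⟨Module.Basis.ofEquivFun (LinearEquiv.ofInjectiveOfFinrankEq E hE (by simp [hdim']; omega)),
    fun A ↦ ?_⟩
  ext t
  rfl

end Frame

section Gram

variable {n : ℕ} {M : Type*} [TopologicalSpace M] [ChartedSpace (Model n) M]
  [IsManifold (𝓡 (n + 1)) ∞ M] {p : ProjectiveStructure n M}
  (D : p.carrier) {s : Fin (n + 1) → ∀ x : M, TangentSpace (𝓡 (n + 1)) x} {u : Set M}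
  (hs : IsLocalFrameOn (𝓡 (n + 1)) (Model n) ∞ s u) {y : M}
  (H : ∀ x : M, LinearMap.BilinForm ℝ (Module.Dual ℝ (Tractor p x)))
  (I : ∀ x : M, Tractor p x)

/-! ### The inverse tractor metric in a tractor frame -/

/-- The matrix `H^{AB}` in a tractor frame. -/
def tractorGram (y : M) : Matrix (Fin (n + 1) ⊕ Unit) (Fin (n + 1) ⊕ Unit) ℝ :=
  Matrix.of fun A B ↦ tractorComp₂ D hs H A B y

/-- The components `Φ_{AB} I^A` of the tractor `I` with its index lowered, in a tractor frame.
The last one is `σ`, and the others are `∇_b σ` wherever `σ` vanishes. -/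
def lowered (B : Fin (n + 1) ⊕ Unit) (y : M) : ℝ :=
  ∑ A, tractorComp D hs I A y * (tractorGram D hs H y)⁻¹ A B

variable {H I}

theorem tractorGram_comm (hH : HasSignature (H y) 2 n) (A B : Fin (n + 1) ⊕ Unit) :
    tractorGram D hs H y A B = tractorGram D hs H y B A :=
  hH.apply_comm _ _

theorem tractorGram_inv_comm (hH : HasSignature (H y) 2 n) (A B : Fin (n + 1) ⊕ Unit) :
    (tractorGram D hs H y)⁻¹ A B = (tractorGram D hs H y)⁻¹ B A := by
  have h : (tractorGram D hs H y).transpose = tractorGram D hs H y := by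
    ext A B
    exact tractorGram_comm D hs hH B A
  conv_lhs => rw [← h, ← Matrix.transpose_nonsing_inv]
  rfl

/-- In the basis dual to the tractor coframe, the matrix of `Φ` is the inverse of that of `H`. -/
theorem phi_matrix_mul_tractorGram (hH : HasSignature (H y) 2 n)
    {e : Module.Basis (Fin (n + 1) ⊕ Unit) ℝ (Tractor p y)}
    (he : ∀ A, e.coord A = dualFrame D hs y A) :
    (Matrix.of fun A B ↦ Phi H y (e A) (e B)) * tractorGram D hs H y = 1 := by
  have hfin : FiniteDimensional ℝ (Tractor p y) := Module.Finite.of_basis e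
  ext A C
  have h1 := inverseForm_spec (H y) hH.nondegenerate (e A) (e.coord C)
  have h2 : inverseForm (H y) (e A) = ∑ B, Phi H y (e A) (e B) • e.coord B :=
    e.ext fun B ↦ by simp [Phi]
  rw [h2] at h1
  simp only [map_sum, map_smul, LinearMap.sum_apply, LinearMap.smul_apply, smul_eq_mul] at h1
  simp only [Matrix.mul_apply, Matrix.of_apply, tractorGram, tractorComp₂, ← he]
  rw [h1, Matrix.one_apply]
  simp [Finsupp.single_apply]

theorem isUnit_det_tractorGram (hy : y ∈ u) (hH : HasSignature (H y) 2 n) :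
    IsUnit (tractorGram D hs H y).det := by
  obtain ⟨e, he⟩ := exists_basis_coord_eq_dualFrame D hs hy hH.finrank_eq
  exact Matrix.isUnit_det_of_left_inverse (phi_matrix_mul_tractorGram D hs hH he)

theorem phi_apply (hy : y ∈ u) (hH : HasSignature (H y) 2 n) (t t' : Tractor p y) :
    Phi H y t t' = ∑ B, (∑ A, dualFrame D hs y A t * (tractorGram D hs H y)⁻¹ A B) *
      dualFrame D hs y B t' := by
  obtain ⟨e, he⟩ := exists_basis_coord_eq_dualFrame D hs hy hH.finrank_eq
  have hinv := Matrix.inv_eq_left_inv (phi_matrix_mul_tractorGram D hs hH he)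
  rw [hinv]
  conv_lhs => rw [← e.sum_repr t, ← e.sum_repr t']
  simp only [map_sum, LinearMap.sum_apply, map_smul, LinearMap.smul_apply, smul_eq_mul,
    Matrix.of_apply, ← he, Module.Basis.coord_apply, Finset.mul_sum, Finset.sum_mul]
  exact Finset.sum_congr rfl fun A _ ↦ Finset.sum_congr rfl fun B _ ↦ by ring

theorem dualFrame_inclX_inl (τ : Density n y (-1)) (i : Fin (n + 1)) :
    dualFrame D hs y (.inl i) (inclX p y τ) = 0 :=
  map_zero (hs.coeff i y)

theorem dualFrame_inclX_inr (τ : Density n y (-1)) :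
    dualFrame D hs y (.inr ()) (inclX p y τ) = τ.1 fun j ↦ s j y :=
  rfl

theorem sigma_apply (hy : y ∈ u) (hH : HasSignature (H y) 2 n) (τ : Density n y (-1)) :
    sigma H I y τ = lowered D hs H I (.inr ()) y * τ.1 fun j ↦ s j y := by
  rw [sigma, LinearMap.comp_apply, phi_apply D hs hy hH, Fintype.sum_sum_type]
  simp [dualFrame_inclX_inl, dualFrame_inclX_inr, lowered, tractorComp]

theorem lam_apply (hy : y ∈ u) (hH : HasSignature (H y) 2 n) (τ τ' : Density n y (-1)) :
    lam H y τ τ' = (tractorGram D hs H y)⁻¹ (.inr ()) (.inr ()) * (τ.1 fun j ↦ s j y) *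
      τ'.1 fun j ↦ s j y := by
  rw [lam, LinearMap.compl₁₂_apply, phi_apply D hs hy hH, Fintype.sum_sum_type]
  simp only [Fintype.sum_sum_type, dualFrame_inclX_inl, dualFrame_inclX_inr, mul_zero, zero_mul, Finset.sum_const_zero,
    zero_add, Finset.univ_unique, Finset.sum_singleton, PUnit.default_eq_unit]
  ring

theorem phi_apply_self (hy : y ∈ u) (hH : HasSignature (H y) 2 n) :
    Phi H y (I y) (I y) = ∑ B, lowered D hs H I B y * tractorComp D hs I B y :=
  phi_apply D hs hy hH _ _

include D hs in
theorem exists_density_apply_eq_one (hy : y ∈ u) (hH : HasSignature (H y) 2 n) :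
    ∃ τ : Density n y (-1), τ.1 (fun j ↦ s j y) = 1 := by
  obtain ⟨e, he⟩ := exists_basis_coord_eq_dualFrame D hs hy hH.finrank_eq
  refine ⟨projY p D y (e (.inr ())), ?_⟩
  have : dualFrame D hs y (.inr ()) (e (.inr ())) = 1 := by rw [← he]; simp
  exact this

include hs in
theorem density_apply_ne_zero (hy : y ∈ u) {τ : Density n y (-1)} (hτ : τ ≠ 0) :
    τ.1 (fun j ↦ s j y) ≠ 0 := fun h ↦
  hτ (Weighted.eq_zero_of_apply_basis (hs.toBasisAt hy) (by rw [coe_toBasisAt]; exact h))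

theorem mem_zeroN_iff (hy : y ∈ u) : y ∈ zeroN I ↔ ∀ i, tractorComp D hs I (.inl i) y = 0 :=
  projZ_eq_zero_iff D hs hy

theorem mem_zeroSigma_iff (hy : y ∈ u) (hH : HasSignature (H y) 2 n) :
    y ∈ zeroSigma H I ↔ lowered D hs H I (.inr ()) y = 0 := by
  constructor
  · intro h
    obtain ⟨τ, hτ⟩ := exists_density_apply_eq_one D hs hy hH
    have h1 := sigma_apply D hs hy (I := I) hH τ
    rw [show sigma H I y = 0 from h, hτ] at h1
    simpa using h1.symm
  · intro h
    refine LinearMap.ext fun τ ↦ ?_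
    rw [sigma_apply D hs hy hH, h]
    simp

theorem mem_zeroLam_iff (hy : y ∈ u) (hH : HasSignature (H y) 2 n) :
    y ∈ zeroLam H ↔ (tractorGram D hs H y)⁻¹ (.inr ()) (.inr ()) = 0 := by
  constructor
  · intro h
    obtain ⟨τ, hτ⟩ := exists_density_apply_eq_one D hs hy hH
    have h1 := lam_apply D hs hy hH τ τ
    rw [show lam H y = 0 from h, hτ] at h1
    simpa using h1.symm
  · intro h
    refine LinearMap.ext₂ fun τ τ' ↦ ?_
    rw [lam_apply D hs hy hH, h]
    simp

theorem mem_posLam_iff (hy : y ∈ u) (hH : HasSignature (H y) 2 n) :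
    y ∈ posLam H ↔ 0 < (tractorGram D hs H y)⁻¹ (.inr ()) (.inr ()) := by
  constructor
  · intro h
    obtain ⟨τ, hτ⟩ := exists_density_apply_eq_one D hs hy hH
    have h1 := h τ (by rintro rfl; simp at hτ)
    rw [lam_apply D hs hy hH, hτ] at h1
    simpa using h1
  · intro h τ hτ
    rw [lam_apply D hs hy hH, mul_assoc]
    exact mul_pos h (mul_self_pos.2 (density_apply_ne_zero hs hy hτ))

theorem mem_negLam_iff (hy : y ∈ u) (hH : HasSignature (H y) 2 n) :
    y ∈ negLam H ↔ (tractorGram D hs H y)⁻¹ (.inr ()) (.inr ()) < 0 := by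
  constructor
  · intro h
    obtain ⟨τ, hτ⟩ := exists_density_apply_eq_one D hs hy hH
    have h1 := h τ (by rintro rfl; simp at hτ)
    rw [lam_apply D hs hy hH, hτ] at h1
    simpa using h1
  · intro h τ hτ
    rw [lam_apply D hs hy hH, mul_assoc]
    exact mul_neg_of_neg_of_pos h (mul_self_pos.2 (density_apply_ne_zero hs hy hτ))

theorem exists_tractorComp_ne_zero (hy : y ∈ u) (hI : I y ≠ 0) : ∃ A, tractorComp D hs I A y ≠ 0 := by
  by_contra! h
  exact hI (eq_zero_of_dualFrame_eq_zero D hs hy h)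

include D hs in
/-- At a zero of `n`, the tractor `I` is a multiple of `X`. -/
theorem zeroN_subset (hy : y ∈ u) (hH : HasSignature (H y) 2 n) (hI : I y ≠ 0)
    (hnull : Phi H y (I y) (I y) = 0) (h : y ∈ zeroN I) :
    y ∈ zeroSigma H I ∧ y ∈ zeroLam H := by
  rw [mem_zeroN_iff D hs hy] at h
  obtain ⟨A, hA⟩ := exists_tractorComp_ne_zero D hs hy hI
  have hr : tractorComp D hs I (.inr ()) y ≠ 0 := by
    rcases A with i | ⟨⟩
    · exact absurd (h i) hA
    · exact hA
  have hl : lowered D hs H I (.inr ()) y =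
      tractorComp D hs I (.inr ()) y * (tractorGram D hs H y)⁻¹ (.inr ()) (.inr ()) := by
    simp [lowered, h]
  have h0 : (tractorGram D hs H y)⁻¹ (.inr ()) (.inr ()) = 0 := by
    rw [phi_apply_self D hs hy hH, Fintype.sum_sum_type] at hnull
    simp only [h, mul_zero, Finset.sum_const_zero, zero_add, Finset.univ_unique,
      Finset.sum_singleton, PUnit.default_eq_unit, hl] at hnull
    simpa [hr] using hnull
  exact ⟨(mem_zeroSigma_iff D hs hy hH).2 (by rw [hl, h0, mul_zero]),
    (mem_zeroLam_iff D hs hy hH).2 h0⟩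

/-- Lowering indices is injective: the combination is `Φ (a I + b X)`. -/
theorem lowered_add_inv_eq_zero (hy : y ∈ u) (hH : HasSignature (H y) 2 n)
    {a b : ℝ}
    (h : ∀ B, a * lowered D hs H I B y + b * (tractorGram D hs H y)⁻¹ (.inr ()) B = 0)
    (A : Fin (n + 1) ⊕ Unit) :
    a * tractorComp D hs I A y + (if A = .inr () then b else 0) = 0 := by
  have hdet := isUnit_det_tractorGram D hs hy hH
  let c : Fin (n + 1) ⊕ Unit → ℝ := fun A ↦
    a * tractorComp D hs I A y + (if A = .inr () then b else 0)
  have hc : Matrix.vecMul c (tractorGram D hs H y)⁻¹ = 0 := by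
    funext B
    have h1 := h B
    simp only [lowered, Finset.mul_sum] at h1
    simp only [Matrix.vecMul, dotProduct, c, add_mul, Finset.sum_add_distrib, ite_mul, zero_mul,
      Finset.sum_ite_eq', Finset.mem_univ, if_true, Pi.zero_apply]
    rw [← h1]
    simp only [mul_assoc]
  have hc0 : c = 0 := by
    have := congrArg (fun w ↦ Matrix.vecMul w (tractorGram D hs H y)) hc
    simpa [Matrix.vecMul_vecMul, Matrix.nonsing_inv_mul _ hdet] using this
  exact congrFun hc0 A

end Gram

/-! ### Derivatives of the components -/

section Derivatives

variable {n : ℕ} {M : Type*} [TopologicalSpace M] [ChartedSpace (Model n) M]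
  [IsManifold (𝓡 (n + 1)) ∞ M] {p : ProjectiveStructure n M}
  (D : p.carrier) {s : Fin (n + 1) → ∀ x : M, TangentSpace (𝓡 (n + 1)) x} {u : Set M}
  (hs : IsLocalFrameOn (𝓡 (n + 1)) (Model n) ∞ s u) (hu : IsOpen u)
  {H : ∀ x : M, LinearMap.BilinForm ℝ (Module.Dual ℝ (Tractor p x))}
  {I : ∀ x : M, Tractor p x} (hH_smooth : IsSmoothTractorForm p H)
  (hH_sig : ∀ x, HasSignature (H x) 2 n) (hI_smooth : IsSmoothTractor p I)

include hu hH_smooth hH_sig in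
theorem contMDiffOn_tractorGram_inv (A B : Fin (n + 1) ⊕ Unit) :
    ContMDiffOn (𝓡 (n + 1)) 𝓘(ℝ, ℝ) ∞ (fun y ↦ (tractorGram D hs H y)⁻¹ A B) u :=
  contMDiffOn_matrix_inv_apply (fun A B ↦ hH_smooth D s u hs hu A B)
    (fun y hy ↦ (isUnit_det_tractorGram D hs hy (hH_sig y)).ne_zero) A B

include hu hH_smooth hH_sig hI_smooth in
theorem contMDiffOn_lowered (B : Fin (n + 1) ⊕ Unit) :
    ContMDiffOn (𝓡 (n + 1)) 𝓘(ℝ, ℝ) ∞ (lowered D hs H I B) u :=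
  contMDiffOn_sum_mul (fun A ↦ hI_smooth D s u hs hu A)
    fun A ↦ contMDiffOn_tractorGram_inv D hs hu hH_smooth hH_sig A B

variable {x : M} (hx : x ∈ u) (v : TangentSpace (𝓡 (n + 1)) x)

include hu hH_smooth hH_sig hx in
/-- `Φ_{AB}` is parallel. -/
theorem mvfderiv_tractorGram_inv (hH_parallel : IsParallelTractorForm p H)
    (A B : Fin (n + 1) ⊕ Unit) :
    mvfderiv (𝓡 (n + 1)) (fun y ↦ (tractorGram D hs H y)⁻¹ A B) x v =
      ∑ C, ((tractorGram D hs H x)⁻¹ A C * tractorConnForm D hs x v C B +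
        tractorConnForm D hs x v C A * (tractorGram D hs H x)⁻¹ C B) := by
  have hux : u ∈ 𝓝 x := hu.mem_nhds hx
  let h := tractorGram D hs H x
  let 𝒜 := tractorConnForm D hs x v
  let dφ : Matrix (Fin (n + 1) ⊕ Unit) (Fin (n + 1) ⊕ Unit) ℝ := Matrix.of fun A B ↦
    mvfderiv (𝓡 (n + 1)) (fun y ↦ (tractorGram D hs H y)⁻¹ A B) x v
  let dh : Matrix (Fin (n + 1) ⊕ Unit) (Fin (n + 1) ⊕ Unit) ℝ := Matrix.of fun A B ↦
    mvfderiv (𝓡 (n + 1)) (tractorComp₂ D hs H A B) x v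
  have hdet : IsUnit h.det := isUnit_det_tractorGram D hs hx (hH_sig x)
  have hdh : dh = -(𝒜 * h) - h * 𝒜.transpose := by
    ext A B
    have h1 := hH_parallel D s u hs hu x hx v A B
    have h2 : (h * 𝒜.transpose) A B = ∑ C, 𝒜 B C * tractorComp₂ D hs H A C x := by
      rw [Matrix.mul_apply]
      exact Finset.sum_congr rfl fun C _ ↦ mul_comm _ _
    rw [Matrix.sub_apply, Matrix.neg_apply, h2, Matrix.mul_apply]
    change mvfderiv (𝓡 (n + 1)) (tractorComp₂ D hs H A B) x v = _
    change _ = -(∑ C, 𝒜 A C * tractorComp₂ D hs H C B x) - _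
    linarith
  have hφ : ∀ A B, MDifferentiableAt (𝓡 (n + 1)) 𝓘(ℝ, ℝ)
      (fun y ↦ (tractorGram D hs H y)⁻¹ A B) x := fun A B ↦
    ((contMDiffOn_tractorGram_inv D hs hu hH_smooth hH_sig A B).contMDiffAt hux).mdifferentiableAt
      (by simp)
  have hh : ∀ A B, MDifferentiableAt (𝓡 (n + 1)) 𝓘(ℝ, ℝ) (tractorComp₂ D hs H A B) x := fun A B ↦
    ((hH_smooth D s u hs hu A B).contMDiffAt hux).mdifferentiableAt (by simp)
  -- differentiate `Φ_{AB} H^{BC} = δ_A^C`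
  have hprod : dφ * h + h⁻¹ * dh = 0 := by
    ext A C
    have h1 := mvfderiv_sum_mul Finset.univ (fun B ↦ hφ A B) (fun B ↦ hh B C) v
    have h2 : (fun y ↦ ∑ B, (tractorGram D hs H y)⁻¹ A B * tractorComp₂ D hs H B C y) =ᶠ[𝓝 x]
        fun _ ↦ (1 : Matrix (Fin (n + 1) ⊕ Unit) (Fin (n + 1) ⊕ Unit) ℝ) A C := by
      filter_upwards [hux] with y hy
      rw [← Matrix.nonsing_inv_mul _ (isUnit_det_tractorGram D hs hy (hH_sig y)), Matrix.mul_apply]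
      rfl
    have h3 : mvfderiv (𝓡 (n + 1))
        (fun y ↦ ∑ B, (tractorGram D hs H y)⁻¹ A B * tractorComp₂ D hs H B C y) x v = 0 := by
      have h4 : mvfderiv (𝓡 (n + 1))
          (fun y ↦ ∑ B, (tractorGram D hs H y)⁻¹ A B * tractorComp₂ D hs H B C y) x = 0 := by
        rw [mvfderiv, h2.mfderiv_eq]
        exact mvfderiv_const _
      rw [h4]; rfl
    rw [h3, Finset.sum_add_distrib] at h1
    exact h1.symm
  have hdφ : dφ = h⁻¹ * 𝒜 + 𝒜.transpose * h⁻¹ := by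
    have h1 : dφ * h * h⁻¹ = -(h⁻¹ * dh) * h⁻¹ := by rw [eq_neg_of_add_eq_zero_left hprod]
    rw [Matrix.mul_nonsing_inv_cancel_right _ _ hdet] at h1
    rw [h1, hdh]
    simp only [mul_sub, mul_neg, neg_sub, sub_neg_eq_add]
    rw [← Matrix.mul_assoc h⁻¹ h, Matrix.nonsing_inv_mul _ hdet, Matrix.one_mul,
      ← Matrix.mul_assoc, add_mul, Matrix.mul_nonsing_inv_cancel_right _ _ hdet]
    exact add_comm _ _
  have h5 := congrFun (congrFun hdφ A) B
  rw [Finset.sum_add_distrib]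
  exact h5

include hu hH_smooth hH_sig hI_smooth hx in
/-- `Φ_{AB} I^A` is parallel. -/
theorem mvfderiv_lowered (hH_parallel : IsParallelTractorForm p H)
    (hI_parallel : IsParallelTractor p I) (B : Fin (n + 1) ⊕ Unit) :
    mvfderiv (𝓡 (n + 1)) (lowered D hs H I B) x v =
      ∑ A, tractorConnForm D hs x v A B * lowered D hs H I A x := by
  have hux : u ∈ 𝓝 x := hu.mem_nhds hx
  have h1 := mvfderiv_sum_mul Finset.univ
    (fun A ↦ ((hI_smooth D s u hs hu A).contMDiffAt hux).mdifferentiableAt (by simp))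
    (fun A ↦ ((contMDiffOn_tractorGram_inv D hs hu hH_smooth hH_sig A B).contMDiffAt
      hux).mdifferentiableAt (by simp)) v
  have h2 : ∀ A, mvfderiv (𝓡 (n + 1)) (tractorComp D hs I A) x v =
      -∑ B, tractorConnForm D hs x v A B * tractorComp D hs I B x := fun A ↦
    eq_neg_of_add_eq_zero_left (hI_parallel D s u hs hu x hx v A)
  simp only [h2, mvfderiv_tractorGram_inv D hs hu hH_smooth hH_sig hx v hH_parallel] at h1
  refine h1.trans ?_
  simp only [lowered, Finset.mul_sum, Finset.sum_add_distrib, mul_add, neg_mul,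
    Finset.sum_mul, Finset.sum_neg_distrib]
  have h3 : ∑ A, ∑ C, tractorConnForm D hs x v A C * tractorComp D hs I C x *
      (tractorGram D hs H x)⁻¹ A B = ∑ A, ∑ C, tractorComp D hs I A x *
        (tractorConnForm D hs x v C A * (tractorGram D hs H x)⁻¹ C B) := by
    rw [Finset.sum_comm]
    exact Finset.sum_congr rfl fun A _ ↦ Finset.sum_congr rfl fun C _ ↦ by ring
  have h4 : ∑ A, ∑ C, tractorComp D hs I A x *
      ((tractorGram D hs H x)⁻¹ A C * tractorConnForm D hs x v C B) =
      ∑ C, ∑ A, tractorConnForm D hs x v C B *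
        (tractorComp D hs I A x * (tractorGram D hs H x)⁻¹ A C) := by
    rw [Finset.sum_comm]
    exact Finset.sum_congr rfl fun A _ ↦ Finset.sum_congr rfl fun C _ ↦ by ring
  rw [h3, h4]
  abel

theorem tractorConnForm_inl_inr (i : Fin (n + 1)) :
    tractorConnForm D hs x v (.inl i) (.inr ()) = hs.coeff i x v := by
  simp [tractorConnForm]

end Derivatives

section Differentials

variable {n : ℕ} {M : Type*} [TopologicalSpace M] [ChartedSpace (Model n) M]
  [IsManifold (𝓡 (n + 1)) ∞ M] {p : ProjectiveStructure n M}
  (D : p.carrier) {s : Fin (n + 1) → ∀ x : M, TangentSpace (𝓡 (n + 1)) x} {u : Set M}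
  (hs : IsLocalFrameOn (𝓡 (n + 1)) (Model n) ∞ s u) (hu : IsOpen u)
  {H : ∀ x : M, LinearMap.BilinForm ℝ (Module.Dual ℝ (Tractor p x))}
  {I : ∀ x : M, Tractor p x} (hH_smooth : IsSmoothTractorForm p H)
  (hH_sig : ∀ x, HasSignature (H x) 2 n) (hH_parallel : IsParallelTractorForm p H)
  (hI_smooth : IsSmoothTractor p I) (hI_parallel : IsParallelTractor p I)
  {x : M} (hx : x ∈ u)

/-! ### Differentials at the zeros of `n`, `σ` and `λ` -/

include hx in
theorem coeff_frame (i j : Fin (n + 1)) :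
    hs.coeff i x (s j x) = if i = j then 1 else 0 := by
  have : hs.coeff i x (s j x) = (hs.toBasisAt hx).repr (hs.toBasisAt hx j) i := by
    rw [IsLocalFrameOn.toBasisAt_coe]
    exact hs.coeff_apply_of_mem hx (s j) i
  rw [this, Module.Basis.repr_self, Finsupp.single_apply]
  simp only [eq_comm]

include hu hx hI_parallel in
/-- At a zero of `n`, the equation `∇_c n^a = -ρ δ_c^a` gives the differential of `n`. -/
theorem mvfderiv_tractorComp_inl (h : ∀ i, tractorComp D hs I (.inl i) x = 0)
    (i j : Fin (n + 1)) :
    mvfderiv (𝓡 (n + 1)) (tractorComp D hs I (.inl i)) x (s j x) =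
      -(if i = j then tractorComp D hs I (.inr ()) x else 0) := by
  have h1 := hI_parallel D s u hs hu x hx (s j x) (.inl i)
  rw [Fintype.sum_sum_type] at h1
  simp only [h, mul_zero, Finset.sum_const_zero, zero_add, Finset.univ_unique,
    Finset.sum_singleton, PUnit.default_eq_unit, tractorConnForm_inl_inr,
    coeff_frame hs hx, ite_mul, one_mul, zero_mul] at h1
  exact eq_neg_of_add_eq_zero_left h1

include hu hH_smooth hH_sig hH_parallel hI_smooth hI_parallel hx in
/-- At a zero of `σ`, the derivatives of `σ` are the other components of `Φ_{AB} I^A`. -/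
theorem mvfderiv_lowered_inr (h : lowered D hs H I (.inr ()) x = 0) (j : Fin (n + 1)) :
    mvfderiv (𝓡 (n + 1)) (lowered D hs H I (.inr ())) x (s j x) =
      lowered D hs H I (.inl j) x := by
  rw [mvfderiv_lowered D hs hu hH_smooth hH_sig hI_smooth hx _ hH_parallel hI_parallel,
    Fintype.sum_sum_type]
  simp [h, tractorConnForm_inl_inr, coeff_frame hs hx]

include hu hH_smooth hH_sig hH_parallel hx in
/-- At a zero of `λ`, the derivatives of `λ` are `2 Φ_{AB} X^A W_j^B`. -/
theorem mvfderiv_tractorGram_inv_inr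
    (h : (tractorGram D hs H x)⁻¹ (.inr ()) (.inr ()) = 0) (j : Fin (n + 1)) :
    mvfderiv (𝓡 (n + 1)) (fun y ↦ (tractorGram D hs H y)⁻¹ (.inr ()) (.inr ())) x (s j x) =
      2 * (tractorGram D hs H x)⁻¹ (.inr ()) (.inl j) := by
  rw [mvfderiv_tractorGram_inv D hs hu hH_smooth hH_sig hx _ hH_parallel,
    Fintype.sum_sum_type]
  simp [h, tractorConnForm_inl_inr, coeff_frame hs hx, Finset.sum_add_distrib,
    tractorGram_inv_comm D hs (hH_sig x) (.inl _) (.inr ())]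
  ring

include hu hx hI_parallel in
theorem linearIndependent_mvfderiv_tractorComp (hI : I x ≠ 0) (h : x ∈ zeroN I) :
    LinearIndependent ℝ fun i : Fin (n + 1) ↦
      mvfderiv (𝓡 (n + 1)) (tractorComp D hs I (.inl i)) x := by
  rw [mem_zeroN_iff D hs hx] at h
  obtain ⟨A, hA⟩ := exists_tractorComp_ne_zero D hs hx hI
  have hr : tractorComp D hs I (.inr ()) x ≠ 0 := by
    rcases A with i | ⟨⟩
    · exact absurd (h i) hA
    · exact hA
  rw [Fintype.linearIndependent_iff]
  intro g hg j
  have h1 := DFunLike.congr_fun hg (s j x)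
  simp only [sum_apply, smul_apply,
    mvfderiv_tractorComp_inl D hs hu hI_parallel hx h, smul_eq_mul,
    zero_apply] at h1
  simpa [hr] using h1

include hu hH_smooth hH_sig hH_parallel hI_smooth hI_parallel hx in
theorem linearIndependent_mvfderiv_sigma (hI : I x ≠ 0) (h : x ∈ zeroSigma H I) :
    LinearIndependent ℝ fun _ : Fin 1 ↦
      mvfderiv (𝓡 (n + 1)) (lowered D hs H I (.inr ())) x := by
  rw [mem_zeroSigma_iff D hs hx (hH_sig x)] at h
  rw [linearIndependent_unique_iff]
  intro h0
  obtain ⟨A, hA⟩ := exists_tractorComp_ne_zero D hs hx hI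
  refine hA ?_
  have h1 := lowered_add_inv_eq_zero D hs (I := I) hx (hH_sig x) (a := 1) (b := 0) ?_ A
  · simpa using h1
  · rintro (j | ⟨⟩)
    · rw [← mvfderiv_lowered_inr D hs hu hH_smooth hH_sig hH_parallel hI_smooth hI_parallel hx h j,
        h0]
      simp
    · simp [h]

include hu hH_smooth hH_sig hH_parallel hI_smooth hI_parallel hx in
/-- If the differentials of `σ` and `λ` were dependent, a combination of `I` and `X` would vanish,
so that `n` would vanish too. -/
theorem linearIndependent_mvfderiv_sigma_lam (hσ : x ∈ zeroSigma H I) (hl : x ∈ zeroLam H)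
    (hn : x ∉ zeroN I) :
    LinearIndependent ℝ fun i : Fin 2 ↦
      mvfderiv (𝓡 (n + 1)) ((![lowered D hs H I (.inr ()),
        fun y ↦ (tractorGram D hs H y)⁻¹ (.inr ()) (.inr ())] : Fin 2 → M → ℝ) i) x := by
  rw [mem_zeroSigma_iff D hs hx (hH_sig x)] at hσ
  rw [mem_zeroLam_iff D hs hx (hH_sig x)] at hl
  rw [mem_zeroN_iff D hs hx] at hn
  push Not at hn
  obtain ⟨i, hi⟩ := hn
  rw [Fintype.linearIndependent_iff]
  intro g hg
  simp only [Fin.sum_univ_two, Matrix.cons_val_zero, Matrix.cons_val_one] at hg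
  have key := lowered_add_inv_eq_zero D hs (I := I) hx (hH_sig x) (a := g 0) (b := 2 * g 1) ?_
  · have h0 : g 0 = 0 := by simpa [hi] using key (.inl i)
    have h1 : g 1 = 0 := by simpa [h0] using key (.inr ())
    intro k
    fin_cases k
    · exact h0
    · exact h1
  · rintro (j | ⟨⟩)
    · have h1 := DFunLike.congr_fun hg (s j x)
      simp only [add_apply, smul_apply, smul_eq_mul,
        mvfderiv_lowered_inr D hs hu hH_smooth hH_sig hH_parallel hI_smooth hI_parallel hx hσ,
        mvfderiv_tractorGram_inv_inr D hs hu hH_smooth hH_sig hH_parallel hx hl,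
        zero_apply] at h1
      linarith
    · simp [hσ, hl]

end Differentials

/-! ### The decomposition -/

section Decomposition

variable {n : ℕ} {M : Type*} [TopologicalSpace M] [ChartedSpace (Model n) M]
  [IsManifold (𝓡 (n + 1)) ∞ M] {p : ProjectiveStructure n M}
  {H : ∀ x : M, LinearMap.BilinForm ℝ (Module.Dual ℝ (Tractor p x))}
  {I : ∀ x : M, Tractor p x}

variable (p) in
theorem exists_scale_frame (x : M) :
    ∃ (_ : p.carrier) (s : Fin (n + 1) → ∀ x : M, TangentSpace (𝓡 (n + 1)) x) (u : Set M),
      IsLocalFrameOn (𝓡 (n + 1)) (Model n) ∞ s u ∧ IsOpen u ∧ x ∈ u := by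
  obtain ⟨D, hD⟩ := p.nonempty
  exact ⟨⟨D, hD⟩, exists_isLocalFrameOn n x⟩

theorem isOpen_of_forall_exists_inter {S : Set M}
    (h : ∀ x, ∃ U : Set M, IsOpen U ∧ x ∈ U ∧ IsOpen (U ∩ S)) : IsOpen S := by
  rw [isOpen_iff_mem_nhds]
  intro x hx
  obtain ⟨U, -, hxU, hUS⟩ := h x
  exact Filter.mem_of_superset (hUS.mem_nhds ⟨hxU, hx⟩) Set.inter_subset_right

theorem isOpen_compl_zeroN (hI_smooth : IsSmoothTractor p I) : IsOpen (zeroN I)ᶜ := by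
  refine isOpen_of_forall_exists_inter fun x ↦ ?_
  obtain ⟨D, s, u, hs, hu, hx⟩ := exists_scale_frame p x
  refine ⟨u, hu, hx, ?_⟩
  have : u ∩ (zeroN I)ᶜ = ⋃ i, u ∩ tractorComp D hs I (.inl i) ⁻¹' {0}ᶜ := by
    ext y
    simp only [Set.mem_inter_iff, Set.mem_compl_iff, Set.mem_iUnion, Set.mem_preimage,
      Set.mem_singleton_iff, exists_and_left]
    refine and_congr_right fun hy ↦ ?_
    rw [mem_zeroN_iff D hs hy, not_forall]
  rw [this]
  exact isOpen_iUnion fun i ↦ (hI_smooth D s u hs hu _).continuousOn.isOpen_inter_preimage hu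
    isOpen_compl_singleton

variable (hH_smooth : IsSmoothTractorForm p H) (hH_sig : ∀ x, HasSignature (H x) 2 n)

include hH_smooth hH_sig

theorem isOpen_orbitO (hI_smooth : IsSmoothTractor p I) : IsOpen (orbitO H I) := by
  refine isOpen_of_forall_exists_inter fun x ↦ ?_
  obtain ⟨D, s, u, hs, hu, hx⟩ := exists_scale_frame p x
  refine ⟨u, hu, hx, ?_⟩
  have : u ∩ orbitO H I = u ∩ lowered D hs H I (.inr ()) ⁻¹' {0}ᶜ := by
    ext y
    exact and_congr_right fun hy ↦ not_congr (mem_zeroSigma_iff D hs hy (hH_sig y))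
  rw [this]
  exact (contMDiffOn_lowered D hs hu hH_smooth hH_sig hI_smooth _).continuousOn.isOpen_inter_preimage
    hu isOpen_compl_singleton

theorem isOpen_posLam : IsOpen (posLam H) := by
  refine isOpen_of_forall_exists_inter fun x ↦ ?_
  obtain ⟨D, s, u, hs, hu, hx⟩ := exists_scale_frame p x
  refine ⟨u, hu, hx, ?_⟩
  have : u ∩ posLam H =
      u ∩ (fun y ↦ (tractorGram D hs H y)⁻¹ (.inr ()) (.inr ())) ⁻¹' Set.Ioi 0 := by
    ext y
    exact and_congr_right fun hy ↦ mem_posLam_iff D hs hy (hH_sig y)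
  rw [this]
  exact (contMDiffOn_tractorGram_inv D hs hu hH_smooth hH_sig _ _).continuousOn.isOpen_inter_preimage
    hu isOpen_Ioi

theorem isOpen_negLam : IsOpen (negLam H) := by
  refine isOpen_of_forall_exists_inter fun x ↦ ?_
  obtain ⟨D, s, u, hs, hu, hx⟩ := exists_scale_frame p x
  refine ⟨u, hu, hx, ?_⟩
  have : u ∩ negLam H =
      u ∩ (fun y ↦ (tractorGram D hs H y)⁻¹ (.inr ()) (.inr ())) ⁻¹' Set.Iio 0 := by
    ext y
    exact and_congr_right fun hy ↦ mem_negLam_iff D hs hy (hH_sig y)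
  rw [this]
  exact (contMDiffOn_tractorGram_inv D hs hu hH_smooth hH_sig _ _).continuousOn.isOpen_inter_preimage
    hu isOpen_Iio

variable (hH_parallel : IsParallelTractorForm p H) (hI_smooth : IsSmoothTractor p I)
  (hI_ne : ∀ x, I x ≠ 0) (hI_parallel : IsParallelTractor p I)

include hI_smooth hI_ne hI_parallel

omit hH_smooth hH_sig in
theorem isEmbeddedSubmanifold_zeroN : IsEmbeddedSubmanifold n (n + 1) (zeroN I) := by
  refine isEmbeddedSubmanifold_of_linearIndependent le_rfl fun x hxN ↦ ?_
  obtain ⟨D, s, u, hs, hu, hx⟩ := exists_scale_frame p x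
  exact ⟨u, hu, hx, fun i ↦ tractorComp D hs I (.inl i),
    fun i ↦ hI_smooth D s u hs hu _,
    linearIndependent_mvfderiv_tractorComp D hs hu hI_parallel hx (hI_ne x) hxN,
    fun y hy ↦ mem_zeroN_iff D hs hy⟩

include hH_parallel

/-- `σ` is a defining function of `𝒵(σ)`, even at the zeros of `n`. -/
theorem isEmbeddedSubmanifold_zeroSigma_inter {V : Set M} (hV : IsOpen V) :
    IsEmbeddedSubmanifold n 1 (zeroSigma H I ∩ V) := by
  refine isEmbeddedSubmanifold_of_linearIndependent (by omega) fun x hxS ↦ ?_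
  obtain ⟨D, s, u, hs, hu, hx⟩ := exists_scale_frame p x
  refine ⟨u ∩ V, hu.inter hV, ⟨hx, hxS.2⟩, fun _ ↦ lowered D hs H I (.inr ()),
    fun _ ↦ (contMDiffOn_lowered D hs hu hH_smooth hH_sig hI_smooth _).mono Set.inter_subset_left,
    linearIndependent_mvfderiv_sigma D hs hu hH_smooth hH_sig hH_parallel hI_smooth hI_parallel hx
      (hI_ne x) hxS.1,
    fun y hy ↦ ?_⟩
  rw [Set.mem_inter_iff, mem_zeroSigma_iff D hs hy.1 (hH_sig y)]
  simp [hy.2]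

omit hI_ne in
theorem isEmbeddedSubmanifold_orbitSigmaZero (hn : 1 ≤ n) :
    IsEmbeddedSubmanifold n 2 (orbitSigmaZero H I) := by
  refine isEmbeddedSubmanifold_of_linearIndependent (by omega) fun x hxS ↦ ?_
  obtain ⟨D, s, u, hs, hu, hx⟩ := exists_scale_frame p x
  refine ⟨u ∩ (zeroN I)ᶜ, hu.inter (isOpen_compl_zeroN hI_smooth), ⟨hx, hxS.2⟩,
    ![lowered D hs H I (.inr ()), fun y ↦ (tractorGram D hs H y)⁻¹ (.inr ()) (.inr ())],
    fun i ↦ ?_,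
    linearIndependent_mvfderiv_sigma_lam D hs hu hH_smooth hH_sig hH_parallel hI_smooth hI_parallel
      hx hxS.1.1 hxS.1.2 hxS.2,
    fun y hy ↦ ?_⟩
  · fin_cases i
    · exact (contMDiffOn_lowered D hs hu hH_smooth hH_sig hI_smooth _).mono Set.inter_subset_left
    · exact (contMDiffOn_tractorGram_inv D hs hu hH_smooth hH_sig _ _).mono Set.inter_subset_left
  · rw [orbitSigmaZero, Set.mem_sdiff, Set.mem_inter_iff, mem_zeroSigma_iff D hs hy.1 (hH_sig y),
      mem_zeroLam_iff D hs hy.1 (hH_sig y), Fin.forall_fin_two]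
    simp [show y ∉ zeroN I from hy.2]

end Decomposition

theorem lam_trichotomy {n : ℕ} {M : Type*} [TopologicalSpace M] [ChartedSpace (Model n) M]
    [IsManifold (𝓡 (n + 1)) ∞ M] {p : ProjectiveStructure n M}
    {H : ∀ x : M, LinearMap.BilinForm ℝ (Module.Dual ℝ (Tractor p x))} {x : M}
    (hH : HasSignature (H x) 2 n) :
    (x ∈ negLam H ∧ x ∉ zeroLam H ∧ x ∉ posLam H) ∨
      (x ∉ negLam H ∧ x ∈ zeroLam H ∧ x ∉ posLam H) ∨
      (x ∉ negLam H ∧ x ∉ zeroLam H ∧ x ∈ posLam H) := by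
  obtain ⟨D, s, u, hs, hu, hx⟩ := exists_scale_frame p x
  rw [mem_negLam_iff D hs hx hH, mem_zeroLam_iff D hs hx hH, mem_posLam_iff D hs hx hH]
  rcases lt_trichotomy ((tractorGram D hs H x)⁻¹ (.inr ()) (.inr ())) 0 with h | h | h
  · exact .inl ⟨h, h.ne, h.not_gt⟩
  · exact .inr (.inl ⟨h.not_lt, h, h.not_gt⟩)
  · exact .inr (.inr ⟨h.not_gt, h.ne', h⟩)

end ProjTractor

end

open ProjTractor in
theorem theorem3p1 (n : ℕ) (hn : 1 ≤ n) {M : Type*} [TopologicalSpace M]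
    [ChartedSpace (Model n) M] [IsManifold (𝓡 (n + 1)) ∞ M] [T2Space M] [CompactSpace M]
    (p : ProjectiveStructure n M)
    (H : ∀ x : M, LinearMap.BilinForm ℝ (Module.Dual ℝ (Tractor p x)))
    (hH_smooth : IsSmoothTractorForm p H)
    (hH_sig : ∀ x, HasSignature (H x) 2 n)
    (hH_parallel : IsParallelTractorForm p H)
    (I : ∀ x : M, Tractor p x)
    (hI_smooth : IsSmoothTractor p I)
    (hI_ne : ∀ x, I x ≠ 0)
    (hI_null : ∀ x, Phi H x (I x) (I x) = 0)
    (hI_parallel : IsParallelTractor p I) :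
    -- the zero set of `n` is finite and consists of isolated points
    (zeroN I).Finite ∧
    (∀ x ∈ zeroN I, ∃ U : Set M, IsOpen U ∧ U ∩ zeroN I = {x}) ∧
    -- its complement is open and is the disjoint union of `𝒪` and `Σ`
    IsOpen (zeroN I)ᶜ ∧
    (zeroN I)ᶜ = orbitO H I ∪ orbitSigma H I ∧
    Disjoint (orbitO H I) (orbitSigma H I) ∧
    IsOpen (orbitO H I) ∧
    IsEmbeddedSubmanifold n 1 (orbitSigma H I) ∧
    -- the decomposition of `Σ`
    orbitSigma H I = orbitSigmaNeg H I ∪ orbitSigmaZero H I ∪ orbitSigmaPos H I ∧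
    Disjoint (orbitSigmaNeg H I) (orbitSigmaZero H I) ∧
    Disjoint (orbitSigmaNeg H I) (orbitSigmaPos H I) ∧
    Disjoint (orbitSigmaZero H I) (orbitSigmaPos H I) ∧
    IsEmbeddedSubmanifold n 1 (orbitSigmaNeg H I) ∧
    IsEmbeddedSubmanifold n 1 (orbitSigmaPos H I) ∧
    IsEmbeddedSubmanifold n 2 (orbitSigmaZero H I) ∧
    -- the overall decomposition
    (Set.univ : Set M) = orbitO H I ∪ orbitSigmaNeg H I ∪ orbitSigmaZero H I ∪
      orbitSigmaPos H I ∪ zeroN I ∧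
    List.Pairwise Disjoint [orbitO H I, orbitSigmaNeg H I, orbitSigmaZero H I,
      orbitSigmaPos H I, zeroN I] := by
  have hemb := isEmbeddedSubmanifold_zeroN hI_smooth hI_ne hI_parallel
  have hiso := fun x hx ↦ hemb.exists_isOpen_inter_eq_singleton (x := x) hx
  have hopen := isOpen_compl_zeroN hI_smooth
  have hsub : ∀ x, x ∈ zeroN I → x ∈ zeroSigma H I ∧ x ∈ zeroLam H := fun x hx ↦ by
    obtain ⟨D, s, u, hs, -, hxu⟩ := exists_scale_frame p x
    exact zeroN_subset D hs hxu (hH_sig x) (hI_ne x) (hI_null x) hx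
  have htri := fun x ↦ lam_trichotomy (hH_sig x)
  have hO : ∀ x, x ∈ orbitO H I ↔ x ∉ zeroSigma H I := fun x ↦ Iff.rfl
  have hsurf : ∀ V : Set M, IsOpen V → IsEmbeddedSubmanifold n 1 (zeroSigma H I ∩ V) := fun V hV ↦
    isEmbeddedSubmanifold_zeroSigma_inter hH_smooth hH_sig hH_parallel hI_smooth hI_ne hI_parallel hV
  refine ⟨?_, hiso, hopen, ?_, ?_, isOpen_orbitO hH_smooth hH_sig hI_smooth, hsurf _ hopen, ?_, ?_,
    ?_, ?_, hsurf _ (isOpen_negLam hH_smooth hH_sig), hsurf _ (isOpen_posLam hH_smooth hH_sig),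
    isEmbeddedSubmanifold_orbitSigmaZero hH_smooth hH_sig hH_parallel hI_smooth hI_parallel hn,
    ?_, ?_⟩
  · refine (isOpen_compl_iff.1 hopen).isCompact.finite ?_
    exact isDiscrete_iff_forall_mem_exists_isOpen.2 hiso
  on_goal 8 =>
    simp only [List.pairwise_cons, List.mem_cons, List.not_mem_nil, or_false, forall_eq_or_imp,
      forall_eq, IsEmpty.forall_iff, implies_true, List.Pairwise.nil, and_true]
  all_goals
    simp only [Set.ext_iff, Set.disjoint_left, orbitSigma, orbitSigmaNeg, orbitSigmaPos,
      orbitSigmaZero, Set.mem_union, Set.mem_inter_iff, Set.mem_sdiff, Set.mem_compl_iff,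
      Set.mem_univ, true_iff, hO]
  · intro x; have := hsub x; tauto
  · intro x; tauto
  · intro x; have := hsub x; have := htri x; tauto
  · intro x; have := htri x; tauto
  · intro x; have := htri x; tauto
  · intro x; have := htri x; tauto
  · intro x; have := hsub x; have := htri x; tauto
  · refine ⟨⟨?_, ?_, ?_, ?_⟩, ⟨?_, ?_, ?_⟩, ⟨?_, ?_⟩, ?_⟩ <;>
    · intro x; have := hsub x; have := htri x; tauto
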